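/- Let $k$ be an infinite field, $R=k[x_1,\dots,x_d]$ with its standard grading, $I\subsetneq R$ a proper homogeneous ideal, and $c=\operatorname{ht}(I)$. Use the graded reverse lexicographic order with $x_1>\dots>x_d$, and let $g=(g_{ij})\in\operatorname{GL}_d(k)$ act on $R$ by $x_i\mapsto\sum_j g_{ij}x_j$. Let $\operatorname{gin}_{rev}(I)$ be the generic initial ideal of $I$, i.e. the common value of $\operatorname{in}(g\cdot I)$ for $g$ in a nonempty Zariski open subset of $\operatorname{GL}_d(k)$. Put $a_0(I)=-\infty$ and, for $1\le i\le d$, $a_i(I)=\min\{n\in\mathbb N\mid x_i^n\in\operatorname{gin}_{rev}(I)\}$, with $a_i(I)=\infty$ if there is no such $n$. For $g\in\operatorname{GL}_d(k)$ put $\ell_i=\sum_j g_{ij}x_j$ and $M^{(i)}=R/(I+(\ell_{i+1},\dots,\ell_d))$. For $0\le s\le d-1$ and $n\in\mathbb N$, the generic annihilator number $\alpha_{s,n}(R/I)$ is the common value of $\dim_k(0:_{M^{(d-s)}}\ell_{d-s})_n$ for $g$ in a nonempty Zariski open subset of $\operatorname{GL}_d(k)$ on which $\ell_d,\dots,\ell_1$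 is an almost regular sequence on $R/I$ (that is, $0:_{M^{(i)}}\ell_i$ is a finite-dimensional $k$-vector space for all $1\le i\le d$). The number $\alpha_{s,n}(R/I)$ is called coextremal if $\alpha_{s,n}(R/I)\ne0$ and $\alpha_{s',n'}(R/I)=0$ for all $(s',n')\ne(s,n)$ with $s\le s'\le d-1$ and $n'\ge n$. Assume that $\operatorname{gin}_{rev}(I)$ is strongly stable: whenever $i<j$ and $\mu$ is a monomial with $\mu x_j\in\operatorname{gin}_{rev}(I)$, also $\mu x_i\in\operatorname{gin}_{rev}(I)$ (for instance, this holds if $\operatorname{char}k=0$). Then: 1. For all $1\le i\le d$ and $j\in\mathbb N$, $$a_{i-1}(I)<a_i(I)=j+1<\infty\iff i\le c\ \text{ and }\ \alpha_{d-i,j}(R/I)\text{ is coextremal}.$$ 2. $\{a_1(I),\dots,a_c(I)\}=\{\,j+1\mid \alpha_{s,j}(R/I)\text{ is coextremal for some } d-c\le s\le d-1\,\}.$ 3. $a_1(I)\le a_2(I)\le\dots\le a_c(I)<\infty$, and for $1\le i\le c$ one has $a_{i-1}(I)<a_i(I)$ if and only if $\alpha_{d-i,j}(R/I)$ is coextremal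 for some $j$. -/

import Mathlib

attribute [local instance] MvPolynomial.gradedAlgebra

namespace AxialConstants

open MvPolynomial

noncomputable section

/-- The graded reverse lexicographic order on monomials, given by their exponent vectors, with
`X 0 > X 1 > ⋯ > X (d - 1)`: `RevLexLT a b` says that the monomial `x ^ a` is strictly smaller than
the monomial `x ^ b`. -/
def RevLexLT {d : ℕ} (a b : Fin d →₀ ℕ) : Prop :=
  a.degree < b.degree ∨
    (a.degree = b.degree ∧ ∃ i, b i < a i ∧ ∀ j, i < j → a j = b j)

/-- `x ^ m` is the leading monomial of `f`. The zero polynomial has none. -/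
def IsLeadingMonomial {d : ℕ} {k : Type*} [Field k]
    (f : MvPolynomial (Fin d) k) (m : Fin d →₀ ℕ) : Prop :=
  m ∈ f.support ∧ ∀ m' ∈ f.support, m' ≠ m → RevLexLT m' m

/-- The initial ideal of `I` for the graded reverse lexicographic order. -/
def initialIdeal {d : ℕ} {k : Type*} [Field k] (I : Ideal (MvPolynomial (Fin d) k)) :
    Ideal (MvPolynomial (Fin d) k) :=
  Ideal.span {p | ∃ f ∈ I, ∃ m, IsLeadingMonomial f m ∧ p = monomial m 1}

/-- The linear form `∑ j, g i j * X j`, given by the `i`-th row of the matrix `g`. -/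
def linForm {d : ℕ} {k : Type*} [Field k] (g : GL (Fin d) k) (i : Fin d) :
    MvPolynomial (Fin d) k :=
  ∑ j, C (g i j) * X j

/-- The linear change of coordinates given by `g`: it sends `X i` to `∑ j, g i j * X j`. -/
def coordChange {d : ℕ} {k : Type*} [Field k] (g : GL (Fin d) k) :
    MvPolynomial (Fin d) k →ₐ[k] MvPolynomial (Fin d) k :=
  aeval (linForm g)

/-- `P` holds on a nonempty Zariski open subset of `GL_d(k)`. Since the principal open sets
`{g | F(g) ≠ 0}`, with `F` a polynomial in the entries, form a base of the Zariski topology, it is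
the same to ask for a nonempty principal open set. -/
def HoldsGenerically {d : ℕ} {k : Type*} [Field k] (P : GL (Fin d) k → Prop) : Prop :=
  ∃ F : MvPolynomial (Fin d × Fin d) k,
    (∃ g : GL (Fin d) k, eval (fun p => g p.1 p.2) F ≠ 0) ∧
    ∀ g : GL (Fin d) k, eval (fun p => g p.1 p.2) F ≠ 0 → P g

/-- `J` is the initial ideal of `g · I` for all `g` in a nonempty Zariski open subset of
`GL_d(k)`. -/
def IsGenericInitialIdeal {d : ℕ} {k : Type*} [Field k]
    (I J : Ideal (MvPolynomial (Fin d) k)) : Prop :=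
  HoldsGenerically fun g : GL (Fin d) k => initialIdeal (I.map (coordChange g)) = J

open Classical in
/-- The reverse lexicographic generic initial ideal of `I`. For a homogeneous ideal `I` over an
infinite field, there is exactly one `J` with `IsGenericInitialIdeal I J`. -/
def ginRev {d : ℕ} {k : Type*} [Field k] (I : Ideal (MvPolynomial (Fin d) k)) :
    Ideal (MvPolynomial (Fin d) k) :=
  if h : ∃ J, IsGenericInitialIdeal I J then h.choose else ⊥

/-- Strongly stable monomial ideals. -/
def IsStronglyStable {d : ℕ} {k : Type*} [Field k] (J : Ideal (MvPolynomial (Fin d) k)) : Prop :=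
  (∃ S : Set (Fin d →₀ ℕ), J = Ideal.span ((fun m => monomial m 1) '' S)) ∧
    ∀ i j : Fin d, i < j → ∀ m : Fin d →₀ ℕ,
      monomial m 1 * X j ∈ J → monomial m 1 * X i ∈ J

/-- The axial constants `a_i(I)`, with the variables numbered from `1` to `d` as
`x_i = X (i - 1)`: `a_0(I) = -∞`, and for `1 ≤ i ≤ d` the constant `a_i(I)` is the least `n` with
`x_i ^ n ∈ gin_rev(I)`, or `∞` if there is none. The value for `i > d` is never used. -/
def axialConstant {d : ℕ} {k : Type*} [Field k] (I : Ideal (MvPolynomial (Fin d) k)) :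
    ℕ → WithBot ℕ∞
  | 0 => ⊥
  | i + 1 =>
    if h : i < d then
      ((⨅ (n : ℕ) (_ : (X ⟨i, h⟩ : MvPolynomial (Fin d) k) ^ n ∈ ginRev I), (n : ℕ∞) : ℕ∞) :
        WithBot ℕ∞)
    else ⊤

/-- The ideal `I + (ℓ j | j > i)`. -/
def sectionIdeal {d : ℕ} {k : Type*} [Field k] (I : Ideal (MvPolynomial (Fin d) k))
    (ℓ : Fin d → MvPolynomial (Fin d) k) (i : Fin d) : Ideal (MvPolynomial (Fin d) k) :=
  I ⊔ Ideal.span (ℓ '' Set.Ioi i)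

/-- The submodule `0 :_M f = {m ∈ M | f m = 0}` of `M = R / K`, as a `k`-vector space. -/
def annihilated {d : ℕ} {k : Type*} [Field k] (K : Ideal (MvPolynomial (Fin d) k))
    (f : MvPolynomial (Fin d) k) : Submodule k (MvPolynomial (Fin d) k ⧸ K) :=
  LinearMap.ker (LinearMap.mulLeft k (Ideal.Quotient.mk K f))

/-- The component of degree `n` of `R / K`. -/
def quotientDegree {d : ℕ} {k : Type*} [Field k] (K : Ideal (MvPolynomial (Fin d) k)) (n : ℕ) :
    Submodule k (MvPolynomial (Fin d) k ⧸ K) :=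
  (homogeneousSubmodule (Fin d) k n).map (Ideal.Quotient.mkₐ k K).toLinearMap

/-- The sequence `ℓ (d - 1), …, ℓ 0`, in this order, is almost regular on `R / I`. -/
def IsAlmostRegular {d : ℕ} {k : Type*} [Field k] (I : Ideal (MvPolynomial (Fin d) k))
    (ℓ : Fin d → MvPolynomial (Fin d) k) : Prop :=
  ∀ i, Module.Finite k (annihilated (sectionIdeal I ℓ i) (ℓ i))

/-- The annihilator numbers `α_{s,n}` of `R / I` with respect to the sequence
`ℓ (d - 1), …, ℓ 0`, for `0 ≤ s ≤ d - 1`: the dimension of the degree `n` component of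
`0 :_M ℓ_{d-s}`, where `M = R / (I + (ℓ_{d-s+1}, …, ℓ_d))` and `ℓ_1, …, ℓ_d` are
`ℓ 0, …, ℓ (d - 1)`. Note that `s.rev = d - s - 1`. -/
def annihilatorNumber {d : ℕ} {k : Type*} [Field k] (I : Ideal (MvPolynomial (Fin d) k))
    (ℓ : Fin d → MvPolynomial (Fin d) k) (s : Fin d) (n : ℕ) : ℕ :=
  Module.finrank k
    ↥(annihilated (sectionIdeal I ℓ s.rev) (ℓ s.rev) ⊓ quotientDegree (sectionIdeal I ℓ s.rev) n)

/-- For all `g` in a nonempty Zariski open subset of `GL_d(k)`, the linear forms given by the rows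
of `g` form an almost regular sequence on `R / I` with annihilator numbers `α`. -/
def AreGenericAnnihilatorNumbers {d : ℕ} {k : Type*} [Field k]
    (I : Ideal (MvPolynomial (Fin d) k)) (α : Fin d → ℕ → ℕ) : Prop :=
  HoldsGenerically fun g : GL (Fin d) k =>
    IsAlmostRegular I (linForm g) ∧ ∀ s n, annihilatorNumber I (linForm g) s n = α s n

open Classical in
/-- The generic annihilator numbers `α_{s,n}(R/I)`, for `0 ≤ s ≤ d - 1`. For a homogeneous ideal `I`
over an infinite field, there is exactly one `α` with `AreGenericAnnihilatorNumbers I α`. -/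
def genericAnnihilatorNumber {d : ℕ} {k : Type*} [Field k]
    (I : Ideal (MvPolynomial (Fin d) k)) (s : Fin d) (n : ℕ) : ℕ :=
  if h : ∃ α, AreGenericAnnihilatorNumbers I α then h.choose s n else 0

/-- The generic annihilator number `α_{s,n}(R/I)` is coextremal. -/
def IsCoextremal {d : ℕ} {k : Type*} [Field k] (I : Ideal (MvPolynomial (Fin d) k))
    (s : Fin d) (n : ℕ) : Prop :=
  genericAnnihilatorNumber I s n ≠ 0 ∧
    ∀ (s' : Fin d) (n' : ℕ), (s', n') ≠ (s, n) → s ≤ s' → n ≤ n' →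
      genericAnnihilatorNumber I s' n' = 0

end

end AxialConstants

/-!
In generic coordinates everything in the statement can be read off the monomial ideal
`gin_rev(I)`, and what remains is combinatorics of strongly stable sets of exponents.

*Generic initial ideals.* In each degree `n`, the number of leading exponents of `g · I` above a
given monomial is lower semicontinuous in `g`: leading exponents are detected by the nonvanishing of
a determinant of coefficients of `g · I`, which are polynomials in the entries of `g`
(`exists_open_ncard_le`). A set of leading exponents for which these numbers are maximal is thus
attained on a nonempty open set. By Dickson's lemma, finitely many degrees suffice. This gives
Galligo's theorem `exists_generic_leadingExps`, so that `ginRev` is what its name says.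

*Annihilator numbers.* For the reverse lexicographic order, passing to the initial ideal commutes
with killing the last variables (`leadingExps_sectionIdeal`) and with the colon by the last of the
remaining ones (`leadingExps_colonDegree`). Since the annihilator numbers with respect to the rows
of `g` are those of `g⁻¹ · I` with respect to the variables, `α_{d-i,n}(R/I)` is the number of
monomials `μ` of degree `n` in `x_1, …, x_i` with `μ ∉ gin_rev(I)` and `μ x_i ∈ gin_rev(I)`
(`genericAnnihilatorNumber_eq_ncard`). For a strongly stable ideal, `μ x_i` is then a minimal
generator; hence there are finitely many such `μ`, and the sequence of rows is almost regular.

*Height.* If the initial ideal contains a power of each variable outside a set `S`, then `R/I`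
is finite over the polynomials in the variables in `S`; this bounds the height of `I` from below, by
the dimension formula (`le_height_of_leadingExps`). If each monomial of the initial ideal involves a
variable outside `S`, then `I` meets these polynomials in zero, which bounds the height from above
(`height_le_of_leadingExps`). For a strongly stable `gin_rev(I)` it follows that `a_i(I) < ∞` if and
only if `i ≤ c` (`exists_single_mem_ginExps_iff`).

*Combinatorics.* Let `i ≤ c`. As `gin_rev(I)` is strongly stable and contains `x_i ^ a_i`, it
contains all monomials of degree at least `a_i` in `x_1, …, x_i`. So `α_{d-i,n}(R/I) = 0` for
`n ≥ a_i`, while `μ = x_i ^ (a_i - 1)` shows that `α_{d-i,n}(R/I) ≠ 0` for `n = a_i - 1`. Therefore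
`α_{d-i,j}(R/I)` is coextremal if and only if `j = a_i - 1` and `a_{i'} < a_i` for all `i' < i`
(`isCoextremal_rev_iff`). Since `a_1 ≤ ⋯ ≤ a_c`, the latter means that `a_{i-1} < a_i`.
-/

namespace AxialConstants

open MvPolynomial

section

variable {d : ℕ} {k : Type*} [Field k]

/-! ### The graded reverse lexicographic order and leading exponents -/

/-- An embedding of the exponent vectors into a linear order which induces `RevLexLT`: the degree
first, then the negated exponents, read from the last variable to the first. -/
noncomputable def revLexKey (m : Fin d →₀ ℕ) : ℕ ×ₗ Lex (Fin d → ℤ) :=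
  toLex (m.degree, toLex fun j => -(m j.rev : ℤ))

lemma revLexKey_injective : Function.Injective (revLexKey (d := d)) := by
  intro a b h
  have h2 : (fun j : Fin d => -(a j.rev : ℤ)) = fun j => -(b j.rev : ℤ) := (Prod.ext_iff.1 h).2
  ext j
  have := congrFun h2 j.rev
  simp only [Fin.rev_rev] at this
  omega

lemma revLexLT_iff {a b : Fin d →₀ ℕ} : RevLexLT a b ↔ revLexKey a < revLexKey b := by
  rw [RevLexLT, Prod.Lex.lt_iff]
  refine or_congr Iff.rfl (and_congr Iff.rfl ?_)
  constructor
  · rintro ⟨i, hi, h⟩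
    refine ⟨i.rev, fun j hj => ?_, ?_⟩
    · have := h j.rev (by rwa [Fin.lt_rev_iff])
      change -(a j.rev : ℤ) = -(b j.rev : ℤ)
      omega
    · change -(a i.rev.rev : ℤ) < -(b i.rev.rev : ℤ)
      rw [Fin.rev_rev]
      omega
  · rintro ⟨i, h, hi⟩
    refine ⟨i.rev, ?_, fun j hj => ?_⟩
    · change -(a i.rev : ℤ) < -(b i.rev : ℤ) at hi
      omega
    · have h' : -(a j.rev.rev : ℤ) = -(b j.rev.rev : ℤ) := h j.rev (Fin.rev_lt_iff.1 hj)
      rw [Fin.rev_rev] at h'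
      omega

lemma RevLexLT.trans {a b c : Fin d →₀ ℕ} (h : RevLexLT a b) (h' : RevLexLT b c) :
    RevLexLT a c := by
  rw [revLexLT_iff] at *
  exact h.trans h'

lemma RevLexLT.irrefl (a : Fin d →₀ ℕ) : ¬ RevLexLT a a := by
  rw [revLexLT_iff]
  exact lt_irrefl _

lemma RevLexLT.degree_le {a b : Fin d →₀ ℕ} (h : RevLexLT a b) : a.degree ≤ b.degree := by
  rcases h with h | h
  · exact h.le
  · exact h.1.le

lemma revLexLT_trichotomy (a b : Fin d →₀ ℕ) : RevLexLT a b ∨ a = b ∨ RevLexLT b a := by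
  simp only [revLexLT_iff]
  rcases lt_trichotomy (revLexKey a) (revLexKey b) with h | h | h
  · exact .inl h
  · exact .inr (.inl (revLexKey_injective h))
  · exact .inr (.inr h)

lemma RevLexLT.add_right {a b : Fin d →₀ ℕ} (h : RevLexLT a b) (c : Fin d →₀ ℕ) :
    RevLexLT (a + c) (b + c) := by
  rcases h with h | ⟨h, i, hi, hj⟩
  · left
    simpa only [map_add] using Nat.add_lt_add_right h _
  · right
    refine ⟨by simp only [map_add, h], i, ?_, fun j hij => ?_⟩
    · simpa using hi
    · simpa using hj j hij

lemma RevLexLT.of_add_right {a b c : Fin d →₀ ℕ} (h : RevLexLT (a + c) (b + c)) :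
    RevLexLT a b := by
  rcases revLexLT_trichotomy a b with h' | rfl | h'
  · exact h'
  · exact absurd h (RevLexLT.irrefl _)
  · exact absurd (h.trans (h'.add_right c)) (RevLexLT.irrefl _)

lemma revLexLT_wellFounded : WellFounded (RevLexLT (d := d)) := by
  have hfin (m : Fin d →₀ ℕ) : {a | RevLexLT a m}.Finite :=
    (Finsupp.finite_of_degree_le m.degree).subset fun a ha => RevLexLT.degree_le ha
  refine Subrelation.wf (r := InvImage (· < ·) fun m => {a | RevLexLT a m}.ncard) ?_
    (InvImage.wf _ wellFounded_lt)
  intro a b h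
  refine Set.ncard_lt_ncard ⟨fun c hc => hc.trans h, fun hs => ?_⟩ (hfin b)
  exact RevLexLT.irrefl a (hs h)

lemma exists_revLex_max (s : Finset (Fin d →₀ ℕ)) (hs : s.Nonempty) :
    ∃ m ∈ s, ∀ m' ∈ s, m' ≠ m → RevLexLT m' m := by
  obtain ⟨m, hm, h⟩ := s.exists_max_image revLexKey hs
  exact ⟨m, hm, fun m' hm' hne => revLexLT_iff.2
    (lt_of_le_of_ne (h m' hm') fun e => hne (revLexKey_injective e))⟩

lemma exists_isLeadingMonomial {f : MvPolynomial (Fin d) k} (hf : f ≠ 0) :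
    ∃ m, IsLeadingMonomial f m := by
  obtain ⟨m, hm, h⟩ := exists_revLex_max f.support (support_nonempty.2 hf)
  exact ⟨m, hm, h⟩

lemma IsLeadingMonomial.coeff_ne_zero {f : MvPolynomial (Fin d) k} {m : Fin d →₀ ℕ}
    (h : IsLeadingMonomial f m) : coeff m f ≠ 0 :=
  mem_support_iff.1 h.1

lemma IsLeadingMonomial.ne_zero {f : MvPolynomial (Fin d) k} {m : Fin d →₀ ℕ}
    (h : IsLeadingMonomial f m) : f ≠ 0 := by
  rintro rfl
  simpa using h.1

lemma IsLeadingMonomial.eq_or_lt {f : MvPolynomial (Fin d) k} {m m' : Fin d →₀ ℕ}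
    (h : IsLeadingMonomial f m) (hm' : coeff m' f ≠ 0) : m' = m ∨ RevLexLT m' m := by
  by_cases e : m' = m
  · exact .inl e
  · exact .inr (h.2 m' (mem_support_iff.2 hm') e)

lemma IsLeadingMonomial.coeff_eq_zero {f : MvPolynomial (Fin d) k} {m m' : Fin d →₀ ℕ}
    (h : IsLeadingMonomial f m) (hm' : RevLexLT m m') : coeff m' f = 0 := by
  by_contra hc
  rcases h.eq_or_lt hc with rfl | h'
  · exact RevLexLT.irrefl _ hm'
  · exact RevLexLT.irrefl _ (h'.trans hm')

lemma IsLeadingMonomial.monomial_mul {f : MvPolynomial (Fin d) k} {m : Fin d →₀ ℕ}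
    (h : IsLeadingMonomial f m) (a : Fin d →₀ ℕ) :
    IsLeadingMonomial (monomial a 1 * f) (m + a) := by
  constructor
  · rw [mem_support_iff, add_comm m a, coeff_monomial_mul, one_mul]
    exact h.coeff_ne_zero
  · intro m' hm' hne
    rw [mem_support_iff, coeff_monomial_mul'] at hm'
    split_ifs at hm' with ha
    · obtain ⟨b, rfl⟩ := exists_add_of_le ha
      rw [add_tsub_cancel_left, one_mul] at hm'
      rw [add_comm a b]
      refine RevLexLT.add_right (h.2 b (mem_support_iff.2 hm') ?_) a
      rintro rfl
      exact hne (add_comm _ _)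
    · exact absurd rfl hm'

lemma isLeadingMonomial_monomial (m : Fin d →₀ ℕ) :
    IsLeadingMonomial (monomial m (1 : k)) m := by
  classical
  constructor
  · simp
  · intro m' hm' hne
    rw [mem_support_iff, coeff_monomial, if_neg (Ne.symm hne)] at hm'
    exact absurd rfl hm'

/-- The leading monomial of `f` is that of its homogeneous component of top degree. -/
lemma IsLeadingMonomial.homogeneousComponent {f : MvPolynomial (Fin d) k} {m : Fin d →₀ ℕ}
    (h : IsLeadingMonomial f m) :
    IsLeadingMonomial (homogeneousComponent m.degree f) m := by
  constructor
  · rw [mem_support_iff, coeff_homogeneousComponent, if_pos rfl]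
    exact h.coeff_ne_zero
  · intro m' hm' hne
    rw [mem_support_iff, coeff_homogeneousComponent] at hm'
    split_ifs at hm'
    · exact h.2 m' (mem_support_iff.2 hm') hne
    · exact absurd rfl hm'

/-- The exponents of the leading monomials of the nonzero elements of `W`. -/
def leadingExps (W : Set (MvPolynomial (Fin d) k)) : Set (Fin d →₀ ℕ) :=
  {m | ∃ f ∈ W, IsLeadingMonomial f m}

lemma leadingExps_mono {V W : Set (MvPolynomial (Fin d) k)} (h : V ⊆ W) :
    leadingExps V ⊆ leadingExps W :=
  fun _ ⟨f, hf, hm⟩ => ⟨f, h hf, hm⟩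

lemma isUpperSet_leadingExps (I : Ideal (MvPolynomial (Fin d) k)) :
    IsUpperSet (leadingExps (I : Set (MvPolynomial (Fin d) k))) := by
  rintro m m' h ⟨f, hf, hm⟩
  obtain ⟨a, rfl⟩ := exists_add_of_le h
  exact ⟨_, I.mul_mem_left (monomial a 1) hf, hm.monomial_mul a⟩

lemma initialIdeal_eq_span (I : Ideal (MvPolynomial (Fin d) k)) :
    initialIdeal I = Ideal.span ((fun m => monomial m 1) ''
      leadingExps (I : Set (MvPolynomial (Fin d) k))) := by
  rw [initialIdeal]
  congr 1
  ext p
  constructor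
  · rintro ⟨f, hf, m, hm, rfl⟩
    exact ⟨m, ⟨f, hf, hm⟩, rfl⟩
  · rintro ⟨m, ⟨f, hf, hm⟩, rfl⟩
    exact ⟨f, hf, m, hm, rfl⟩

lemma monomial_mem_initialIdeal {I : Ideal (MvPolynomial (Fin d) k)} {m : Fin d →₀ ℕ} :
    monomial m (1 : k) ∈ initialIdeal I ↔ m ∈ leadingExps (I : Set (MvPolynomial (Fin d) k)) := by
  classical
  rw [initialIdeal_eq_span, mem_ideal_span_monomial_image, support_monomial, if_neg one_ne_zero]
  simp only [Finset.mem_singleton, forall_eq]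
  exact ⟨fun ⟨a, ha, h⟩ => isUpperSet_leadingExps I h ha, fun h => ⟨m, h, le_rfl⟩⟩

/-- The elements of degree `n` of the ideal `I`. -/
noncomputable def idealDegree (I : Ideal (MvPolynomial (Fin d) k)) (n : ℕ) :
    Submodule k (MvPolynomial (Fin d) k) :=
  I.restrictScalars k ⊓ homogeneousSubmodule (Fin d) k n

lemma mem_idealDegree {I : Ideal (MvPolynomial (Fin d) k)} {n : ℕ} {f : MvPolynomial (Fin d) k} :
    f ∈ idealDegree I n ↔ f ∈ I ∧ f.IsHomogeneous n := Iff.rfl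

lemma IsLeadingMonomial.degree_eq {f : MvPolynomial (Fin d) k} {m : Fin d →₀ ℕ} {n : ℕ}
    (h : IsLeadingMonomial f m) (hf : f.IsHomogeneous n) : m.degree = n := by
  have := hf h.coeff_ne_zero
  rw [Finsupp.degree_eq_weight_one]
  exact this

lemma leadingExps_idealDegree {I : Ideal (MvPolynomial (Fin d) k)}
    (hI : I.IsHomogeneous (homogeneousSubmodule (Fin d) k)) (n : ℕ) :
    leadingExps (idealDegree I n : Set (MvPolynomial (Fin d) k)) =
      {m ∈ leadingExps (I : Set (MvPolynomial (Fin d) k)) | m.degree = n} := by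
  ext m
  constructor
  · rintro ⟨f, hf, hm⟩
    exact ⟨⟨f, hf.1, hm⟩, hm.degree_eq hf.2⟩
  · rintro ⟨⟨f, hf, hm⟩, rfl⟩
    exact ⟨_, ⟨homogeneousComponent_mem_of_mem hI hf _, homogeneousComponent_isHomogeneous _ _⟩,
      hm.homogeneousComponent⟩

/-! ### Dimension and leading exponents -/

/-- Division with remainder: modulo a subspace `W`, every polynomial is congruent to one which
involves no leading exponent of `W`. -/
lemma exists_remainder (W : Submodule k (MvPolynomial (Fin d) k)) (f : MvPolynomial (Fin d) k) :
    ∃ r, f - r ∈ W ∧ ∀ m ∈ r.support, m ∉ leadingExps (W : Set (MvPolynomial (Fin d) k)) := by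
  have key : ∀ m : Fin d →₀ ℕ, ∀ f : MvPolynomial (Fin d) k, IsLeadingMonomial f m →
      ∃ r, f - r ∈ W ∧ ∀ m ∈ r.support, m ∉ leadingExps (W : Set (MvPolynomial (Fin d) k)) := by
    intro m
    induction m using revLexLT_wellFounded.induction with
    | _ m ih =>
      intro f hf
      -- a multiple of an element with leading exponent `m` cancels the leading term of `f`
      have step : ∀ w : MvPolynomial (Fin d) k, IsLeadingMonomial w m →
          ∃ r, f - (coeff m f / coeff m w) • w - r ∈ W ∧
            ∀ m ∈ r.support, m ∉ leadingExps (W : Set (MvPolynomial (Fin d) k)) := by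
        intro w hw
        set f' := f - (coeff m f / coeff m w) • w with hf'
        by_cases h0 : f' = 0
        · exact ⟨0, by simp [h0], by simp⟩
        · obtain ⟨m', hm'⟩ := exists_isLeadingMonomial h0
          refine ih m' ?_ f' hm'
          have hc := hm'.coeff_ne_zero
          rw [hf', coeff_sub, coeff_smul, smul_eq_mul] at hc
          by_contra hlt
          rcases revLexLT_trichotomy m' m with h | h | h
          · exact hlt h
          · subst h
            rw [div_mul_cancel₀ _ hw.coeff_ne_zero, sub_self] at hc
            exact hc rfl
          · rw [hf.coeff_eq_zero h, hw.coeff_eq_zero h] at hc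
            simp at hc
      by_cases hm : m ∈ leadingExps (W : Set (MvPolynomial (Fin d) k))
      · obtain ⟨w, hwW, hw⟩ := hm
        obtain ⟨r, hr, hr'⟩ := step w hw
        refine ⟨r, ?_, hr'⟩
        have := W.add_mem hr (W.smul_mem (coeff m f / coeff m w) hwW)
        convert this using 1
        ring
      · classical
        obtain ⟨r, hr, hr'⟩ := step _ (isLeadingMonomial_monomial m)
        refine ⟨r + (coeff m f / coeff m (monomial m (1 : k))) • monomial m 1, ?_, ?_⟩
        · convert hr using 1
          ring
        · intro m' hm'
          rcases Finset.mem_union.1 (support_add hm') with h | h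
          · exact hr' m' h
          · have := support_monomial_subset (support_smul h)
            rw [Finset.mem_singleton] at this
            rwa [this]
  by_cases h0 : f = 0
  · exact ⟨0, by simp [h0], by simp⟩
  · obtain ⟨m, hm⟩ := exists_isLeadingMonomial h0
    exact key m f hm

/-- Polynomials with distinct leading monomials are linearly independent. -/
lemma linearIndependent_of_leading {ι : Type*} {b : ι → MvPolynomial (Fin d) k}
    {e : ι → Fin d →₀ ℕ} (he : Function.Injective e) (hb : ∀ i, IsLeadingMonomial (b i) (e i)) :
    LinearIndependent k b := by
  classical
  rw [linearIndependent_iff']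
  intro s g hg i hi
  by_contra hne
  obtain ⟨m, hm, hmax⟩ := exists_revLex_max ((s.filter fun i => g i ≠ 0).image e)
    ⟨e i, Finset.mem_image_of_mem _ (by simp [hi, hne])⟩
  obtain ⟨j, hj, rfl⟩ := Finset.mem_image.1 hm
  obtain ⟨hjs, hj0⟩ := Finset.mem_filter.1 hj
  have h := congrArg (coeff (e j)) hg
  rw [coeff_sum, Finset.sum_eq_single_of_mem j hjs] at h
  · simp [hj0, (hb j).coeff_ne_zero] at h
  · intro l hl hlj
    rw [coeff_smul, smul_eq_mul]
    by_cases hl0 : g l = 0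
    · simp [hl0]
    · have := hmax (e l) (Finset.mem_image_of_mem _ (by simp [hl, hl0])) fun h => hlj (he h)
      rw [(hb l).coeff_eq_zero this, mul_zero]

/-- Polynomials in `W` with the leading exponents of `W` form a basis of `W`. If one side is `0`
because of infinitely many elements, then so is the other. -/
lemma finrank_eq_ncard_leadingExps (W : Submodule k (MvPolynomial (Fin d) k)) :
    Module.finrank k W = (leadingExps (W : Set (MvPolynomial (Fin d) k))).ncard := by
  choose b hbW hb using fun m : leadingExps (W : Set (MvPolynomial (Fin d) k)) => m.2
  have hli : LinearIndependent k b := linearIndependent_of_leading Subtype.val_injective hb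
  have hspan : Submodule.span k (Set.range b) = W := by
    refine le_antisymm (Submodule.span_le.2 ?_) fun f hf => ?_
    · rintro _ ⟨m, rfl⟩
      exact hbW m
    · obtain ⟨r, hr, hr'⟩ := exists_remainder (Submodule.span k (Set.range b)) f
      have hle : Submodule.span k (Set.range b) ≤ W := Submodule.span_le.2 (by
        rintro _ ⟨m, rfl⟩
        exact hbW m)
      by_cases h0 : r = 0
      · simpa [h0] using hr
      · obtain ⟨m, hm⟩ := exists_isLeadingMonomial h0
        have hrW : r ∈ W := by
          have := W.sub_mem hf (hle hr)
          rwa [sub_sub_cancel] at this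
        exact absurd ⟨b ⟨m, r, hrW, hm⟩, Submodule.subset_span ⟨_, rfl⟩, hb _⟩ (hr' m hm.1)
  have := Module.finrank_eq_nat_card_basis (Module.Basis.span hli)
  rw [hspan, Nat.card_coe_set_eq] at this
  exact this

/-- If the coefficients of polynomials `f t` in `W` at the exponents in `T` form an invertible
matrix, then above every threshold `W` has at least as many leading exponents as `T` has
elements. -/
lemma ncard_le_ncard_leadingExps_of_det_ne_zero (W : Submodule k (MvPolynomial (Fin d) k))
    (hW : (leadingExps (W : Set (MvPolynomial (Fin d) k))).Finite) (T : Finset (Fin d →₀ ℕ))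
    (f : T → MvPolynomial (Fin d) k) (hf : ∀ t, f t ∈ W)
    (hdet : (Matrix.of fun s t : T => coeff s.1 (f t)).det ≠ 0) (U : Set (Fin d →₀ ℕ))
    (hU : ∀ a ∈ U, ∀ b, RevLexLT a b → b ∈ U) :
    ((T : Set (Fin d →₀ ℕ)) ∩ U).ncard ≤
      (leadingExps (W : Set (MvPolynomial (Fin d) k)) ∩ U).ncard := by
  classical
  set M : Matrix T T k := Matrix.of fun s t : T => coeff s.1 (f t) with hM
  -- the dual family: `h t` has coefficient `1` at `t` and `0` at the other elements of `T`
  let h : T → MvPolynomial (Fin d) k := fun t => ∑ j, M⁻¹ j t • f j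
  have hcoeff (s t : T) : coeff s.1 (h t) = if s = t then 1 else 0 := by
    have : (M * M⁻¹) s t = if s = t then 1 else 0 := by
      rw [Matrix.mul_nonsing_inv _ (isUnit_iff_ne_zero.2 hdet), Matrix.one_apply]
    rw [← this, Matrix.mul_apply, coeff_sum]
    exact Finset.sum_congr rfl fun j _ => by
      rw [coeff_smul, smul_eq_mul, mul_comm, hM, Matrix.of_apply]
  let T' := {t : T // t.1 ∈ U}
  let W' : Submodule k (MvPolynomial (Fin d) k) := Submodule.span k (Set.range fun t : T' => h t.1)
  have hcomb (c : T' → k) (t : T') : coeff t.1.1 (∑ s : T', c s • h s.1) = c t := by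
    rw [coeff_sum, Finset.sum_eq_single_of_mem t (Finset.mem_univ _)]
    · rw [coeff_smul, hcoeff, if_pos rfl, smul_eq_mul, mul_one]
    · intro s _ hst
      rw [coeff_smul, hcoeff, if_neg fun e => hst (Subtype.ext e.symm), smul_zero]
  have hli : LinearIndependent k fun t : T' => h t.1 := by
    rw [Fintype.linearIndependent_iff]
    intro c hc t
    rw [← hcomb c t, hc, coeff_zero]
  have hsub : leadingExps (W' : Set (MvPolynomial (Fin d) k)) ⊆
      leadingExps (W : Set (MvPolynomial (Fin d) k)) ∩ U := by
    rintro m ⟨p, hp, hm⟩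
    refine ⟨⟨p, ?_, hm⟩, ?_⟩
    · refine Submodule.span_le.2 ?_ hp
      rintro _ ⟨t, rfl⟩
      exact W.sum_mem fun j _ => W.smul_mem _ (hf j)
    · obtain ⟨c, rfl⟩ := (Submodule.mem_span_range_iff_exists_fun k).1 hp
      obtain ⟨t, ht⟩ : ∃ t, c t ≠ 0 := by
        by_contra! hc
        exact hm.ne_zero (by simp [hc])
      rw [← hcomb c t] at ht
      rcases hm.eq_or_lt ht with e | hlt
      · exact e ▸ t.2
      · exact hU _ t.2 _ hlt
  have hcard : ((T : Set (Fin d →₀ ℕ)) ∩ U).ncard =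
      (leadingExps (W' : Set (MvPolynomial (Fin d) k))).ncard := by
    rw [← finrank_eq_ncard_leadingExps, finrank_span_eq_card hli, ← Nat.card_eq_fintype_card,
      ← Nat.card_coe_set_eq]
    exact Nat.card_congr (Equiv.subtypeSubtypeEquivSubtypeInter _ _).symm
  rw [hcard]
  exact Set.ncard_le_ncard hsub (hW.inter_of_left _)

/-- Polynomials with distinct leading exponents have an invertible matrix of coefficients at
these exponents: it is triangular for the term order. -/
lemma det_coeff_ne_zero_of_leading (T : Finset (Fin d →₀ ℕ)) (f : T → MvPolynomial (Fin d) k)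
    (hf : ∀ t, IsLeadingMonomial (f t) t.1) :
    (Matrix.of fun s t : T => coeff s.1 (f t)).det ≠ 0 := by
  classical
  intro h0
  obtain ⟨v, hv, hMv⟩ := Matrix.exists_mulVec_eq_zero_iff.2 h0
  obtain ⟨t, ht⟩ := Function.ne_iff.1 hv
  have hlead : ∃ t, v t ≠ 0 ∧ ∀ s, v s ≠ 0 → s ≠ t → RevLexLT s.1 t.1 := by
    obtain ⟨m, hm, hmax⟩ := exists_revLex_max ((Finset.univ.filter fun i => v i ≠ 0).image
      Subtype.val) ⟨t.1, Finset.mem_image_of_mem _ (by simpa using ht)⟩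
    obtain ⟨t, ht, rfl⟩ := Finset.mem_image.1 hm
    exact ⟨t, by simpa using ht, fun s hs hst => hmax s.1
      (Finset.mem_image_of_mem _ (by simpa using hs)) fun e => hst (Subtype.ext e)⟩
  obtain ⟨t, ht, hmax⟩ := hlead
  have h := congrFun hMv t
  rw [Matrix.mulVec, dotProduct, Finset.sum_eq_single_of_mem t (Finset.mem_univ _)] at h
  · simp [ht, (hf t).coeff_ne_zero] at h
  · intro s _ hst
    by_cases hs : v s = 0
    · simp [hs]
    · rw [Matrix.of_apply, (hf s).coeff_eq_zero (hmax s hs hst), zero_mul]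

/-- A finite set of exponents is determined by the number of its elements above each threshold: at
the largest element of a symmetric difference, the numbers differ. -/
lemma eq_of_ncard_upper_eq {S T E : Set (Fin d →₀ ℕ)} (hE : E.Finite) (hS : S ⊆ E) (hT : T ⊆ E)
    (h : ∀ m ∈ E, (S ∩ {a | a = m ∨ RevLexLT m a}).ncard =
      (T ∩ {a | a = m ∨ RevLexLT m a}).ncard) : S = T := by
  by_contra hne
  have hfin : (symmDiff S T).Finite := hE.subset fun a ha => by
    rcases ha with ha | ha
    · exact hS ha.1
    · exact hT ha.1
  obtain ⟨m, hm, hmax⟩ := exists_revLex_max hfin.toFinset (by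
    rw [Set.Finite.toFinset_nonempty, Set.symmDiff_nonempty]
    exact hne)
  simp only [Set.Finite.mem_toFinset] at hm hmax
  have hiff (a) (ha : RevLexLT m a) : a ∈ S ↔ a ∈ T := by
    by_contra hc
    have hmem : a ∈ symmDiff S T := by
      rw [Set.mem_symmDiff]
      tauto
    have hne : a ≠ m := by
      rintro rfl
      exact RevLexLT.irrefl _ ha
    exact RevLexLT.irrefl _ (ha.trans (hmax a hmem hne))
  -- the sets agree above `m`, and exactly one of them contains `m`
  have aux : ∀ {A B : Set (Fin d →₀ ℕ)}, A ⊆ E → B ⊆ E → m ∈ A → m ∉ B →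
      (∀ a, RevLexLT m a → (a ∈ A ↔ a ∈ B)) →
      (B ∩ {a | a = m ∨ RevLexLT m a}).ncard < (A ∩ {a | a = m ∨ RevLexLT m a}).ncard := by
    intro A B hA hB hmA hmB hAB
    refine Set.ncard_lt_ncard ⟨?_, fun hs => hmB (hs ⟨hmA, .inl rfl⟩).1⟩
      ((hE.subset hA).inter_of_left _)
    rintro a ⟨haB, rfl | ha⟩
    · exact absurd haB hmB
    · exact ⟨(hAB a ha).2 haB, .inr ha⟩
  rcases hm with ⟨h1, h2⟩ | ⟨h1, h2⟩
  · exact (aux hS hT h1 h2 hiff).ne (h m (hS h1)).symm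
  · exact (aux hT hS h1 h2 fun a ha => (hiff a ha).symm).ne (h m (hT h1))

/-! ### Linear changes of coordinates -/

lemma coordChange_X (g : GL (Fin d) k) (i : Fin d) : coordChange g (X i) = linForm g i :=
  aeval_X _ _

lemma coordChange_comp (g h : GL (Fin d) k) :
    (coordChange g).comp (coordChange h) = coordChange (h * g) := by
  ext1 i
  rw [AlgHom.comp_apply, coordChange_X, coordChange_X, linForm, linForm]
  simp only [map_sum, map_mul, coordChange_X, algHom_C, linForm, algebraMap_eq, Units.val_mul,
    Matrix.mul_apply, Finset.sum_mul, Finset.mul_sum]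
  rw [Finset.sum_comm]
  exact Finset.sum_congr rfl fun j _ => Finset.sum_congr rfl fun l _ => by ring

lemma coordChange_one : coordChange (1 : GL (Fin d) k) = AlgHom.id k _ := by
  classical
  ext1 i
  rw [coordChange_X, linForm, AlgHom.id_apply, Finset.sum_eq_single_of_mem i (Finset.mem_univ _)]
  · simp
  · intro j _ hj
    simp [Matrix.one_apply_ne (Ne.symm hj)]

/-- The linear change of coordinates as an automorphism. -/
noncomputable def coordEquiv (g : GL (Fin d) k) :
    MvPolynomial (Fin d) k ≃ₐ[k] MvPolynomial (Fin d) k :=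
  AlgEquiv.ofAlgHom (coordChange g) (coordChange g⁻¹)
    (by rw [coordChange_comp, inv_mul_cancel, coordChange_one])
    (by rw [coordChange_comp, mul_inv_cancel, coordChange_one])

lemma coordChange_inv_apply (g : GL (Fin d) k) (f : MvPolynomial (Fin d) k) :
    coordChange g (coordChange g⁻¹ f) = f :=
  (coordEquiv g).apply_symm_apply f

lemma mem_map_coordChange {g : GL (Fin d) k} {I : Ideal (MvPolynomial (Fin d) k)}
    {f : MvPolynomial (Fin d) k} :
    f ∈ I.map (coordChange g) ↔ ∃ h ∈ I, coordChange g h = f :=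
  Ideal.mem_map_iff_of_surjective _ (coordEquiv g).surjective

lemma map_coordChange_inv (g : GL (Fin d) k) (I : Ideal (MvPolynomial (Fin d) k)) :
    (I.map (coordChange g⁻¹)).map (coordChange g) = I := by
  ext f
  simp only [mem_map_coordChange, exists_exists_and_eq_and, coordChange_inv_apply, exists_eq_right]

lemma map_coordChange_ne_top {g : GL (Fin d) k} {I : Ideal (MvPolynomial (Fin d) k)}
    (hI : I ≠ ⊤) : I.map (coordChange g) ≠ ⊤ := by
  rw [Ne, Ideal.eq_top_iff_one, mem_map_coordChange]
  rintro ⟨f, hf, h⟩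
  refine hI ((Ideal.eq_top_iff_one I).2 ?_)
  rwa [← (coordEquiv g).injective (a₁ := f) (a₂ := 1) (by rw [map_one]; exact h)]

lemma height_map_coordChange (g : GL (Fin d) k) (I : Ideal (MvPolynomial (Fin d) k)) :
    (I.map (coordChange g)).height = I.height :=
  (coordEquiv g).toRingEquiv.height_map I

lemma isHomogeneous_linForm (g : GL (Fin d) k) (i : Fin d) : (linForm g i).IsHomogeneous 1 :=
  IsHomogeneous.sum _ _ _ fun _ _ => isHomogeneous_C_mul_X _ _

lemma isHomogeneous_coordChange {f : MvPolynomial (Fin d) k} {n : ℕ} (hf : f.IsHomogeneous n)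
    (g : GL (Fin d) k) : (coordChange g f).IsHomogeneous n := by
  have := hf.aeval (n := 1) _ (isHomogeneous_linForm g)
  rwa [one_mul] at this

lemma homogeneousComponent_coordChange (g : GL (Fin d) k) (n : ℕ) (f : MvPolynomial (Fin d) k) :
    homogeneousComponent n (coordChange g f) = coordChange g (homogeneousComponent n f) := by
  conv_lhs => rw [← sum_homogeneousComponent f, map_sum, map_sum]
  have (i : ℕ) : homogeneousComponent n (coordChange g (homogeneousComponent i f)) =
      if n = i then coordChange g (homogeneousComponent i f) else 0 :=
    homogeneousComponent_of_mem
      (isHomogeneous_coordChange (homogeneousComponent_isHomogeneous i f) g)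
  simp only [this, Finset.sum_ite_eq, Finset.mem_range]
  split_ifs with h
  · rfl
  · rw [homogeneousComponent_eq_zero _ _ (by omega), map_zero]

lemma isHomogeneous_map_coordChange {I : Ideal (MvPolynomial (Fin d) k)}
    (hI : I.IsHomogeneous (homogeneousSubmodule (Fin d) k)) (g : GL (Fin d) k) :
    (I.map (coordChange g)).IsHomogeneous (homogeneousSubmodule (Fin d) k) := by
  intro n f hf
  obtain ⟨h, hh, rfl⟩ := mem_map_coordChange.1 hf
  have e : (DirectSum.decompose (homogeneousSubmodule (Fin d) k) (coordChange g h) n :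
      MvPolynomial (Fin d) k) = homogeneousComponent n (coordChange g h) :=
    decomposition.decompose'_apply _ n
  rw [e, homogeneousComponent_coordChange]
  exact Ideal.mem_map_of_mem _ (homogeneousComponent_mem_of_mem hI hh n)

lemma idealDegree_map_coordChange (I : Ideal (MvPolynomial (Fin d) k)) (g : GL (Fin d) k) (n : ℕ) :
    idealDegree (I.map (coordChange g)) n =
      (idealDegree I n).map (coordEquiv g).toLinearEquiv.toLinearMap := by
  ext f
  rw [mem_idealDegree, mem_map_coordChange, Submodule.mem_map]
  constructor
  · rintro ⟨⟨h, hh, rfl⟩, hf⟩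
    refine ⟨h, ⟨hh, ?_⟩, rfl⟩
    have := isHomogeneous_coordChange hf g⁻¹
    rwa [show coordChange g⁻¹ (coordChange g h) = h from (coordEquiv g).symm_apply_apply h] at this
  · rintro ⟨h, ⟨hh, hn⟩, rfl⟩
    exact ⟨⟨h, hh, rfl⟩, isHomogeneous_coordChange hn g⟩

lemma finrank_idealDegree_map_coordChange (I : Ideal (MvPolynomial (Fin d) k)) (g : GL (Fin d) k)
    (n : ℕ) : Module.finrank k (idealDegree (I.map (coordChange g)) n) =
      Module.finrank k (idealDegree I n) := by
  rw [idealDegree_map_coordChange]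
  exact LinearEquiv.finrank_map_eq (coordEquiv g).toLinearEquiv _

/-! ### Generic properties -/

/-- The values of the entries of a matrix, at which polynomials in the entries are evaluated. -/
abbrev entries (g : GL (Fin d) k) : Fin d × Fin d → k := fun p => g p.1 p.2

lemma eval_det_mvPolynomialX (x : Fin d × Fin d → k) :
    eval x (Matrix.mvPolynomialX (Fin d) (Fin d) k).det =
      (Matrix.of fun i j => x (i, j)).det := by
  rw [RingHom.map_det]
  congr 1
  ext i j
  simp [Matrix.mvPolynomialX]

lemma exists_GL_eval_ne_zero [Infinite k] {F : MvPolynomial (Fin d × Fin d) k} (hF : F ≠ 0) :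
    ∃ g : GL (Fin d) k, eval (entries g) F ≠ 0 := by
  have h0 : F * (Matrix.mvPolynomialX (Fin d) (Fin d) k).det ≠ 0 :=
    mul_ne_zero hF (Matrix.det_mvPolynomialX_ne_zero _ _)
  obtain ⟨x, hx⟩ : ∃ x, eval x (F * (Matrix.mvPolynomialX (Fin d) (Fin d) k).det) ≠ 0 := by
    by_contra! h
    exact h0 (MvPolynomial.funext fun x => by rw [h x, map_zero])
  rw [map_mul, eval_det_mvPolynomialX] at hx
  exact ⟨Matrix.GeneralLinearGroup.mkOfDetNeZero _ (right_ne_zero_of_mul hx),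
    left_ne_zero_of_mul hx⟩

lemma HoldsGenerically.exists {P : GL (Fin d) k → Prop} (h : HoldsGenerically P) : ∃ g, P g :=
  let ⟨_, ⟨g, hg⟩, h⟩ := h
  ⟨g, h g hg⟩

lemma HoldsGenerically.mono {P Q : GL (Fin d) k → Prop} (h : HoldsGenerically P)
    (hPQ : ∀ g, P g → Q g) : HoldsGenerically Q :=
  let ⟨F, hF, h⟩ := h
  ⟨F, hF, fun g hg => hPQ g (h g hg)⟩

/-- Nonempty Zariski open subsets of `GL_d(k)` meet, as `k` is infinite. -/
lemma HoldsGenerically.and [Infinite k] {P Q : GL (Fin d) k → Prop} (hP : HoldsGenerically P)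
    (hQ : HoldsGenerically Q) : HoldsGenerically fun g => P g ∧ Q g := by
  obtain ⟨F, ⟨a, ha⟩, hF⟩ := hP
  obtain ⟨G, ⟨b, hb⟩, hG⟩ := hQ
  have hF0 : F ≠ 0 := by
    rintro rfl
    simp at ha
  have hG0 : G ≠ 0 := by
    rintro rfl
    simp at hb
  refine ⟨F * G, exists_GL_eval_ne_zero (mul_ne_zero hF0 hG0), fun g hg => ?_⟩
  rw [map_mul] at hg
  exact ⟨hF g (left_ne_zero_of_mul hg), hG g (right_ne_zero_of_mul hg)⟩

lemma HoldsGenerically.forall_lt [Infinite k] {P : ℕ → GL (Fin d) k → Prop}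
    (hP : ∀ n, HoldsGenerically (P n)) (N : ℕ) : HoldsGenerically fun g => ∀ n < N, P n g := by
  induction N with
  | zero => exact ⟨1, ⟨1, by simp⟩, by simp⟩
  | succ N ih =>
    refine (ih.and (hP N)).mono fun g hg n hn => ?_
    rcases Nat.lt_succ_iff_lt_or_eq.1 hn with h | rfl
    · exact hg.1 n h
    · exact hg.2

/-- Inversion preserves nonempty Zariski open sets: a polynomial in the entries of `g⁻¹`, times a
power of `det g`, is a polynomial in the entries of `g`. -/
lemma HoldsGenerically.inv {P : GL (Fin d) k → Prop} (hP : HoldsGenerically P) :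
    HoldsGenerically fun g => P g⁻¹ := by
  classical
  obtain ⟨F, ⟨a, ha⟩, hF⟩ := hP
  let A := Matrix.mvPolynomialX (Fin d) (Fin d) k
  let G : MvPolynomial (Fin d × Fin d) k := ∑ m ∈ F.support, C (coeff m F) *
    (∏ p, A.adjugate p.1 p.2 ^ m p) * A.det ^ (F.totalDegree - m.degree)
  have key (g : GL (Fin d) k) : eval (entries g) G =
      g.val.det ^ F.totalDegree * eval (entries g⁻¹) F := by
    have hA : A.map (eval (entries g)) = g.val := by
      ext i j
      simp [A, Matrix.mvPolynomialX]
    have hdet : eval (entries g) A.det = g.val.det := by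
      rw [RingHom.map_det, ← hA]
      rfl
    have hg : g.val.det ≠ 0 := Matrix.GeneralLinearGroup.det_ne_zero g
    have hadj (p : Fin d × Fin d) : eval (entries g) (A.adjugate p.1 p.2) =
        g.val.det * entries g⁻¹ p := by
      have h1 : (A.adjugate.map (eval (entries g))) = g.val.adjugate := by
        have := RingHom.map_adjugate (eval (entries g)) A
        rw [RingHom.mapMatrix_apply, RingHom.mapMatrix_apply, hA] at this
        exact this
      have h2 : (g⁻¹).val = g.val⁻¹ := Matrix.coe_units_inv g
      have h3 := congrFun (congrFun h1 p.1) p.2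
      rw [Matrix.map_apply] at h3
      rw [h3, entries, h2, Matrix.inv_def, Matrix.smul_apply, Ring.inverse_eq_inv', smul_eq_mul,
        mul_inv_cancel_left₀ hg]
    simp only [G, map_sum, map_mul, map_prod, map_pow, eval_C, hdet, hadj]
    rw [eval_eq', Finset.mul_sum]
    refine Finset.sum_congr rfl fun m hm => ?_
    have hle : m.degree ≤ F.totalDegree := by
      rw [Finsupp.degree_eq_weight_one]
      simpa [Finsupp.weight_apply] using le_totalDegree hm
    simp only [mul_pow, Finset.prod_mul_distrib, Finset.prod_pow_eq_pow_sum]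
    rw [← Finsupp.degree_eq_sum]
    calc _ = (g.val.det ^ m.degree * g.val.det ^ (F.totalDegree - m.degree)) *
          (coeff m F * ∏ i, entries g⁻¹ i ^ m i) := by ring
      _ = _ := by rw [← pow_add, Nat.add_sub_cancel' hle]
  refine ⟨G, ⟨a⁻¹, ?_⟩, fun g hg => hF _ ?_⟩
  · rw [key, inv_inv]
    exact mul_ne_zero (pow_ne_zero _ (Matrix.GeneralLinearGroup.det_ne_zero _)) ha
  · rw [key] at hg
    exact right_ne_zero_of_mul hg

/-! ### Existence of the generic initial ideal -/

/-- The coefficients of `coordChange g f` are polynomials in the entries of `g`. -/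
lemma exists_coeff_coordChange_eq_eval (f : MvPolynomial (Fin d) k) (m : Fin d →₀ ℕ) :
    ∃ F : MvPolynomial (Fin d × Fin d) k, ∀ g : GL (Fin d) k,
      coeff m (coordChange g f) = eval (entries g) F := by
  -- the change of coordinates by the matrix of indeterminates
  let φ : MvPolynomial (Fin d) k →ₐ[k] MvPolynomial (Fin d) (MvPolynomial (Fin d × Fin d) k) :=
    aeval fun i => ∑ j, C (X (i, j)) * X j
  refine ⟨coeff m (φ f), fun g => ?_⟩
  have h : (coordChange g : MvPolynomial (Fin d) k →+* MvPolynomial (Fin d) k) =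
      (map (eval (entries g))).comp (φ : MvPolynomial (Fin d) k →+* _) := by
    refine MvPolynomial.ringHom_ext (fun r => ?_) fun i => ?_
    · have : φ (C r) = C (C r) := by
        rw [algHom_C]
        rfl
      simp [algHom_C, this]
    · simp [coordChange_X, linForm, φ]
  have := congrArg (coeff m) (RingHom.congr_fun h f)
  rwa [RingHom.comp_apply, coeff_map] at this

/-- Among sets of exponents of bounded size, a set with the greatest total number of elements above
all thresholds is the only one with at least as many elements above each threshold. -/
lemma exists_maximal_upper_counts {G : Type*} [Nonempty G] (L : G → Set (Fin d →₀ ℕ))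
    {E : Set (Fin d →₀ ℕ)} (hE : E.Finite) (hL : ∀ g, L g ⊆ E) :
    ∃ h, ∀ g, (∀ m, (L h ∩ {a | a = m ∨ RevLexLT m a}).ncard ≤
      (L g ∩ {a | a = m ∨ RevLexLT m a}).ncard) → L g = L h := by
  let Φ : G → ℕ := fun g => ∑ m ∈ hE.toFinset, (L g ∩ {a | a = m ∨ RevLexLT m a}).ncard
  have hbound (g) : Φ g ≤ ∑ m ∈ hE.toFinset, E.ncard := Finset.sum_le_sum fun m _ =>
    Set.ncard_le_ncard (Set.inter_subset_left.trans (hL g)) hE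
  have hbdd : BddAbove (Set.range Φ) := ⟨_, by rintro _ ⟨g, rfl⟩; exact hbound g⟩
  obtain ⟨h, hh⟩ := Nat.sSup_mem (Set.range_nonempty Φ) hbdd
  refine ⟨h, fun g hle => ?_⟩
  have hmax : Φ g ≤ Φ h := hh ▸ le_csSup hbdd ⟨g, rfl⟩
  have heq := (Finset.sum_eq_sum_iff_of_le fun m _ => hle m).1
    (le_antisymm (Finset.sum_le_sum fun m _ => hle m) hmax)
  exact eq_of_ncard_upper_eq hE (hL g) (hL h) fun m hm =>
    (heq m (hE.mem_toFinset.2 hm)).symm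

lemma finite_leadingExps_idealDegree (I : Ideal (MvPolynomial (Fin d) k)) (n : ℕ) :
    (leadingExps (idealDegree I n : Set (MvPolynomial (Fin d) k))).Finite :=
  (Finsupp.finite_of_degree_eq n).subset fun _ ⟨_, hf, hm⟩ => hm.degree_eq hf.2

/-- The number of leading exponents of degree `n` of `g · I` above each threshold is lower
semicontinuous in `g` for the Zariski topology. -/
lemma exists_open_ncard_le (I : Ideal (MvPolynomial (Fin d) k)) (n : ℕ) (h : GL (Fin d) k) :
    ∃ F : MvPolynomial (Fin d × Fin d) k, eval (entries h) F ≠ 0 ∧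
      ∀ g : GL (Fin d) k, eval (entries g) F ≠ 0 → ∀ m,
        (leadingExps (idealDegree (I.map (coordChange h)) n : Set (MvPolynomial (Fin d) k)) ∩
          {a | a = m ∨ RevLexLT m a}).ncard ≤
        (leadingExps (idealDegree (I.map (coordChange g)) n : Set (MvPolynomial (Fin d) k)) ∩
          {a | a = m ∨ RevLexLT m a}).ncard := by
  classical
  obtain ⟨T, hT⟩ := (finite_leadingExps_idealDegree (I.map (coordChange h)) n).exists_finset_coe
  have hex (t : T) : ∃ f ∈ idealDegree I n, IsLeadingMonomial (coordChange h f) t.1 := by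
    obtain ⟨p, hp, hpt⟩ : t.1 ∈ leadingExps
      (idealDegree (I.map (coordChange h)) n : Set (MvPolynomial (Fin d) k)) := hT ▸ t.2
    rw [idealDegree_map_coordChange] at hp
    obtain ⟨f, hf, rfl⟩ := hp
    exact ⟨f, hf, hpt⟩
  choose f hfI hf using hex
  choose F hF using fun s t : T => exists_coeff_coordChange_eq_eval (f t) s.1
  have hdet (g : GL (Fin d) k) : eval (entries g) (Matrix.of F).det =
      (Matrix.of fun s t : T => coeff s.1 (coordChange g (f t))).det := by
    rw [RingHom.map_det]
    congr 1
    ext s t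
    rw [RingHom.mapMatrix_apply, Matrix.map_apply, Matrix.of_apply, Matrix.of_apply, hF]
  refine ⟨(Matrix.of F).det, ?_, fun g hg m => ?_⟩
  · rw [hdet]
    exact det_coeff_ne_zero_of_leading T _ hf
  · rw [hdet] at hg
    rw [← hT]
    refine ncard_le_ncard_leadingExps_of_det_ne_zero _ (finite_leadingExps_idealDegree _ n) T _
      (fun t => ?_) hg _ ?_
    · exact ⟨Ideal.mem_map_of_mem _ (hfI t).1, isHomogeneous_coordChange (hfI t).2 g⟩
    · rintro a (rfl | ha) b hab
      · exact .inr hab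
      · exact .inr (ha.trans hab)

/-- In each degree, the set of leading exponents of `g · I` is the same for generic `g`. -/
lemma exists_generic_leadingExps_degree (I : Ideal (MvPolynomial (Fin d) k)) (n : ℕ) :
    ∃ L : Set (Fin d →₀ ℕ), HoldsGenerically fun g : GL (Fin d) k =>
      leadingExps (idealDegree (I.map (coordChange g)) n : Set (MvPolynomial (Fin d) k)) = L := by
  obtain ⟨h, hh⟩ := exists_maximal_upper_counts (fun g : GL (Fin d) k =>
    leadingExps (idealDegree (I.map (coordChange g)) n : Set (MvPolynomial (Fin d) k)))
    (Finsupp.finite_of_degree_eq n) fun g _ ⟨_, hf, hm⟩ => hm.degree_eq hf.2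
  obtain ⟨F, hF, hFg⟩ := exists_open_ncard_le I n h
  exact ⟨_, F, ⟨h, hF⟩, fun g hg => hh g (hFg g hg)⟩

/-- **Galligo's theorem**: for generic `g` the ideal `g · I` has the same leading exponents. -/
lemma exists_generic_leadingExps [Infinite k] {I : Ideal (MvPolynomial (Fin d) k)}
    (hI : I.IsHomogeneous (homogeneousSubmodule (Fin d) k)) :
    ∃ N : Set (Fin d →₀ ℕ), HoldsGenerically fun g : GL (Fin d) k =>
      leadingExps (I.map (coordChange g) : Set (MvPolynomial (Fin d) k)) = N := by
  choose L hL using exists_generic_leadingExps_degree I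
  have hdeg (g : GL (Fin d) k) (n : ℕ) :
      leadingExps (idealDegree (I.map (coordChange g)) n : Set (MvPolynomial (Fin d) k)) =
      {m ∈ leadingExps (I.map (coordChange g) : Set (MvPolynomial (Fin d) k)) | m.degree = n} :=
    leadingExps_idealDegree (isHomogeneous_map_coordChange hI g) n
  have hLcard (n : ℕ) : (L n).ncard = Module.finrank k (idealDegree I n) := by
    obtain ⟨g, hg⟩ := (hL n).exists
    rw [← hg, ← finrank_eq_ncard_leadingExps, finrank_idealDegree_map_coordChange]
  have hLdeg (n : ℕ) : ∀ a ∈ L n, a.degree = n := by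
    obtain ⟨g, hg⟩ := (hL n).exists
    rw [hdeg] at hg
    intro a ha
    rw [← hg] at ha
    exact ha.2
  obtain ⟨N, hN⟩ : ∃ N : Set (Fin d →₀ ℕ), ∀ m, m ∈ N ↔ m ∈ L m.degree :=
    ⟨{m | m ∈ L m.degree}, fun _ => Iff.rfl⟩
  -- the minimal elements of `N` have bounded degree, by Dickson's lemma
  have hmin : {m | Minimal (· ∈ N) m}.Finite :=
    WellQuasiOrderedLE.finite_of_isAntichain (setOfPred_minimal_antichain _)
  obtain ⟨D, hD⟩ : ∃ D, ∀ m, Minimal (· ∈ N) m → m.degree < D := by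
    obtain ⟨D, hD⟩ := (hmin.image Finsupp.degree).bddAbove
    exact ⟨D + 1, fun m hm => Nat.lt_succ_of_le (hD ⟨m, hm, rfl⟩)⟩
  refine ⟨N, (HoldsGenerically.forall_lt hL D).mono fun g hg => ?_⟩
  have hsub : N ⊆ leadingExps (I.map (coordChange g) : Set (MvPolynomial (Fin d) k)) := by
    intro m hm
    obtain ⟨a, ham, ha⟩ := (Set.isPWO_of_wellQuasiOrderedLE N).exists_le_minimal hm
    refine isUpperSet_leadingExps _ ham ?_
    have haN := (hN a).1 ha.prop
    rw [← hg _ (hD a ha), hdeg] at haN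
    exact haN.1
  refine Set.Subset.antisymm (fun m hm => (hN m).2 ?_) hsub
  -- in each degree the two sets have as many elements as the dimension of the ideal
  have hle : L m.degree ⊆
      leadingExps (idealDegree (I.map (coordChange g)) m.degree :
        Set (MvPolynomial (Fin d) k)) := by
    intro a ha
    have had := hLdeg _ a ha
    rw [hdeg]
    exact ⟨hsub ((hN a).2 (had ▸ ha)), had⟩
  have heq := Set.eq_of_subset_of_ncard_le hle (by
    rw [hLcard, ← finrank_eq_ncard_leadingExps, finrank_idealDegree_map_coordChange])
    (finite_leadingExps_idealDegree _ _)
  rw [heq, hdeg]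
  exact ⟨hm, rfl⟩

lemma isGenericInitialIdeal_ginRev [Infinite k] {I : Ideal (MvPolynomial (Fin d) k)}
    (hI : I.IsHomogeneous (homogeneousSubmodule (Fin d) k)) :
    IsGenericInitialIdeal I (ginRev I) := by
  classical
  have h : ∃ J, IsGenericInitialIdeal I J := by
    obtain ⟨N, hN⟩ := exists_generic_leadingExps hI
    exact ⟨Ideal.span ((fun m => monomial m 1) '' N), hN.mono fun g hg => by
      rw [initialIdeal_eq_span, hg]⟩
  rw [ginRev, dif_pos h]
  exact h.choose_spec

/-- The exponents of the monomials in the generic initial ideal. -/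
def ginExps (I : Ideal (MvPolynomial (Fin d) k)) : Set (Fin d →₀ ℕ) :=
  {m | monomial m (1 : k) ∈ ginRev I}

lemma generic_leadingExps_eq_ginExps [Infinite k] {I : Ideal (MvPolynomial (Fin d) k)}
    (hI : I.IsHomogeneous (homogeneousSubmodule (Fin d) k)) :
    HoldsGenerically fun g : GL (Fin d) k =>
      leadingExps (I.map (coordChange g) : Set (MvPolynomial (Fin d) k)) = ginExps I :=
  (isGenericInitialIdeal_ginRev hI).mono fun g hg => by
    ext m
    rw [ginExps, Set.mem_ofPred_eq, ← hg, monomial_mem_initialIdeal]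

/-! ### Coordinate sections and the reverse lexicographic order -/

lemma mem_span_X_Ioi {i : Fin d} {f : MvPolynomial (Fin d) k} :
    f ∈ Ideal.span ((X : Fin d → MvPolynomial (Fin d) k) '' Set.Ioi i) ↔
      ∀ m ∈ f.support, ∃ j, i < j ∧ m j ≠ 0 := by
  rw [mem_ideal_span_X_image]
  rfl

lemma isHomogeneous_span_X_Ioi (i : Fin d) :
    (Ideal.span ((X : Fin d → MvPolynomial (Fin d) k) '' Set.Ioi i)).IsHomogeneous
      (homogeneousSubmodule (Fin d) k) := by
  refine Ideal.homogeneous_span _ _ ?_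
  rintro _ ⟨j, _, rfl⟩
  exact ⟨1, isHomogeneous_X _ _⟩

lemma isHomogeneous_sectionIdeal_X {I : Ideal (MvPolynomial (Fin d) k)}
    (hI : I.IsHomogeneous (homogeneousSubmodule (Fin d) k)) (i : Fin d) :
    (sectionIdeal I X i).IsHomogeneous (homogeneousSubmodule (Fin d) k) :=
  hI.sup (isHomogeneous_span_X_Ioi i)

/-- In a fixed degree, monomials which involve a variable after the `i`-th are smaller than those
which do not. -/
lemma revLexLT_of_ne_zero {a b : Fin d →₀ ℕ} (h : a.degree = b.degree) {i : Fin d}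
    (ha : ∃ j, i < j ∧ a j ≠ 0) (hb : ∀ j, i < j → b j = 0) : RevLexLT a b := by
  obtain ⟨j, hj, haj⟩ := ha
  obtain ⟨l, hl, hmax⟩ := a.support.exists_max_image id ⟨j, Finsupp.mem_support_iff.2 haj⟩
  have hjl : j ≤ l := hmax j (Finsupp.mem_support_iff.2 haj)
  refine .inr ⟨h, l, ?_, fun t ht => ?_⟩
  · rw [hb l (hj.trans_le hjl)]
    exact Nat.pos_of_ne_zero (Finsupp.mem_support_iff.1 hl)
  · rw [hb t ((hj.trans_le hjl).trans ht)]
    by_contra hc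
    exact absurd (hmax t (Finsupp.mem_support_iff.2 hc)) (not_le_of_gt ht)

/-- Passing to initial ideals commutes with setting the last variables equal to zero. -/
lemma leadingExps_sectionIdeal {I : Ideal (MvPolynomial (Fin d) k)}
    (hI : I.IsHomogeneous (homogeneousSubmodule (Fin d) k)) (i : Fin d) :
    leadingExps (sectionIdeal I X i : Set (MvPolynomial (Fin d) k)) =
      {m | m ∈ leadingExps (I : Set (MvPolynomial (Fin d) k)) ∨ ∃ j, i < j ∧ m j ≠ 0} := by
  classical
  ext m
  constructor
  · rintro ⟨f, hf, hm⟩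
    by_contra hc
    simp only [Set.mem_ofPred_eq, not_or, not_exists, not_and, not_not] at hc
    obtain ⟨hmI, hm0⟩ := hc
    obtain ⟨h, hh, s, hs, rfl⟩ := Submodule.mem_sup.1 hf
    have hm' := hm.homogeneousComponent
    rw [map_add] at hm'
    have hs' := homogeneousComponent_mem_of_mem (isHomogeneous_span_X_Ioi i) hs m.degree
    rw [mem_span_X_Ioi] at hs'
    have hcoeff (a : Fin d →₀ ℕ) (ha : ∀ j, i < j → a j = 0) :
        coeff a (homogeneousComponent m.degree s) = 0 := by
      by_contra hne
      obtain ⟨j, hj, hj0⟩ := hs' a (mem_support_iff.2 hne)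
      exact hj0 (ha j hj)
    refine hmI ⟨homogeneousComponent m.degree h, homogeneousComponent_mem_of_mem hI hh _, ?_, ?_⟩
    · have := hm'.coeff_ne_zero
      rwa [coeff_add, hcoeff m hm0, add_zero, ← mem_support_iff] at this
    · intro a ha hne
      by_cases ha0 : ∀ j, i < j → a j = 0
      · refine hm'.2 a ?_ hne
        rwa [mem_support_iff, coeff_add, hcoeff a ha0, add_zero, ← mem_support_iff]
      · push Not at ha0
        refine revLexLT_of_ne_zero ?_ ha0 hm0
        rw [support_homogeneousComponent, Finset.mem_filter] at ha
        exact ha.2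
  · rintro (h | h)
    · exact leadingExps_mono (SetLike.coe_subset_coe.2 le_sup_left) h
    · refine ⟨monomial m 1, ?_, isLeadingMonomial_monomial m⟩
      refine Submodule.mem_sup_right (mem_span_X_Ioi.2 fun a ha => ?_)
      rw [Finset.mem_singleton.1 (support_monomial_subset ha)]
      exact h

/-- The polynomials of degree `n` whose product with `f` lies in `K`. -/
noncomputable def colonDegree (K : Ideal (MvPolynomial (Fin d) k)) (f : MvPolynomial (Fin d) k)
    (n : ℕ) : Submodule k (MvPolynomial (Fin d) k) :=
  (K.restrictScalars k).comap (LinearMap.mulLeft k f) ⊓ homogeneousSubmodule (Fin d) k n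

lemma IsLeadingMonomial.X_mul {f : MvPolynomial (Fin d) k} {m : Fin d →₀ ℕ}
    (h : IsLeadingMonomial f m) (i : Fin d) :
    IsLeadingMonomial (X i * f) (m + Finsupp.single i 1) :=
  h.monomial_mul _

/-- Passing to initial ideals commutes with the colon by the last remaining variable: if the
leading monomial of a homogeneous polynomial in the first variables is divisible by the last of
these, then so are its other monomials. -/
lemma leadingExps_colonDegree {I : Ideal (MvPolynomial (Fin d) k)}
    (hI : I.IsHomogeneous (homogeneousSubmodule (Fin d) k)) (i : Fin d) (n : ℕ) :
    leadingExps (colonDegree (sectionIdeal I X i) (X i) n : Set (MvPolynomial (Fin d) k)) =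
      {m | m.degree = n ∧ m + Finsupp.single i 1 ∈
        leadingExps (sectionIdeal I X i : Set (MvPolynomial (Fin d) k))} := by
  classical
  ext m
  constructor
  · rintro ⟨f, hf, hm⟩
    exact ⟨hm.degree_eq hf.2, _, hf.1, hm.X_mul i⟩
  · rintro ⟨hmn, f, hf, hm⟩
    by_cases hm0 : ∃ j, i < j ∧ m j ≠ 0
    · refine ⟨monomial m 1, ⟨?_, isHomogeneous_monomial _ hmn⟩, isLeadingMonomial_monomial m⟩
      refine Ideal.mul_mem_left _ _ (Submodule.mem_sup_right (mem_span_X_Ioi.2 fun a ha => ?_))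
      rwa [Finset.mem_singleton.1 (support_monomial_subset ha)]
    · push Not at hm0
      have hdeg : (m + Finsupp.single i 1).degree = n + 1 := by simp [hmn]
      set f' := homogeneousComponent (n + 1) f with hf'
      have hf'K : f' ∈ sectionIdeal I X i :=
        homogeneousComponent_mem_of_mem (isHomogeneous_sectionIdeal_X hI i) hf _
      have hf'm : IsLeadingMonomial f' (m + Finsupp.single i 1) := by
        have := hm.homogeneousComponent
        rwa [hdeg] at this
      have hf'h : f'.IsHomogeneous (n + 1) := homogeneousComponent_isHomogeneous _ _
      refine ⟨f'.divMonomial (Finsupp.single i 1), ⟨?_, ?_⟩, ?_, ?_⟩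
      · have hmod : f'.modMonomial (Finsupp.single i 1) ∈ sectionIdeal I X i := by
          refine Submodule.mem_sup_right (mem_span_X_Ioi.2 fun a ha => ?_)
          rw [mem_support_iff] at ha
          have hai : a i = 0 := by
            by_contra hai
            refine ha (coeff_modMonomial_of_le _ ?_)
            rw [Finsupp.single_le_iff]
            omega
          rw [coeff_modMonomial_of_not_le _ (by rw [Finsupp.single_le_iff]; omega)] at ha
          by_contra! ha0
          -- otherwise `a` would be greater than the leading exponent
          rcases hf'm.eq_or_lt ha with e | hlt
          · rw [e] at hai
            simp at hai
          · have hdega : a.degree = n + 1 := by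
              have := hf'h ha
              rwa [Finsupp.degree_eq_weight_one]
            rcases hlt with hlt | ⟨-, t, ht, htt⟩
            · omega
            · rcases lt_trichotomy t i with h | rfl | h
              · have := htt i h
                simp [hai] at this
              · omega
              · rw [ha0 t h] at ht
                omega
        have := Submodule.sub_mem _ hf'K hmod
        rwa [sub_eq_of_eq_add (divMonomial_add_modMonomial f' (Finsupp.single i 1)).symm] at this
      · intro a ha
        rw [coeff_divMonomial] at ha
        have := hf'h ha
        rw [map_add] at this
        simp only [Finsupp.weight_single] at this
        simp at this
        omega
      · rw [mem_support_iff, coeff_divMonomial, add_comm]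
        exact hf'm.coeff_ne_zero
      · intro a ha hne
        rw [mem_support_iff, coeff_divMonomial, add_comm, ← mem_support_iff] at ha
        exact (hf'm.2 _ ha fun e => hne (add_right_cancel e)).of_add_right

/-! ### Annihilator numbers as numbers of monomials -/

/-- For a set `N` of exponents, the exponents `m` in the variables up to the `i`-th such that `m` is
not in `N` but `m + e_i` is. For the exponents of a monomial ideal `J`, these are the monomials
which form a basis of `0 : x_i` in `R / (J + (x_{i+1}, …, x_d))`. -/
def sectionAnnihilatorExps (N : Set (Fin d →₀ ℕ)) (i : Fin d) : Set (Fin d →₀ ℕ) :=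
  {m | (∀ j, i < j → m j = 0) ∧ m ∉ N ∧ m + Finsupp.single i 1 ∈ N}

lemma mem_sectionAnnihilatorExps_iff {I : Ideal (MvPolynomial (Fin d) k)}
    (hI : I.IsHomogeneous (homogeneousSubmodule (Fin d) k)) {i : Fin d} {m : Fin d →₀ ℕ} :
    m ∈ sectionAnnihilatorExps (leadingExps (I : Set (MvPolynomial (Fin d) k))) i ↔
      m ∉ leadingExps (sectionIdeal I X i : Set (MvPolynomial (Fin d) k)) ∧
      m + Finsupp.single i 1 ∈ leadingExps (sectionIdeal I X i : Set (MvPolynomial (Fin d) k)) := by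
  classical
  rw [leadingExps_sectionIdeal hI]
  simp only [sectionAnnihilatorExps, Set.mem_ofPred_eq, not_or, not_exists, not_and, not_not]
  constructor
  · rintro ⟨h1, h2, h3⟩
    exact ⟨⟨h2, h1⟩, .inl h3⟩
  · rintro ⟨⟨h2, h1⟩, h3 | ⟨j, hj, h3⟩⟩
    · exact ⟨h1, h2, h3⟩
    · rw [Finsupp.add_apply, h1 j hj, Finsupp.single_eq_of_ne hj.ne'] at h3
      exact absurd rfl h3

lemma annihilated_inf_quotientDegree (K : Ideal (MvPolynomial (Fin d) k))
    (f : MvPolynomial (Fin d) k) (n : ℕ) :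
    annihilated K f ⊓ quotientDegree K n =
      (colonDegree K f n).map (Ideal.Quotient.mkₐ k K).toLinearMap := by
  ext y
  constructor
  · rintro ⟨hy, p, hp, rfl⟩
    refine ⟨p, ⟨?_, hp⟩, rfl⟩
    have hy' : Ideal.Quotient.mk K f * Ideal.Quotient.mk K p = 0 := hy
    rw [← map_mul, Ideal.Quotient.eq_zero_iff_mem] at hy'
    exact hy'
  · rintro ⟨p, ⟨hp, hpn⟩, rfl⟩
    refine ⟨?_, p, hpn, rfl⟩
    change Ideal.Quotient.mk K f * Ideal.Quotient.mk K p = 0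
    rw [← map_mul, Ideal.Quotient.eq_zero_iff_mem]
    exact hp

lemma finrank_map_mk_add (K : Ideal (MvPolynomial (Fin d) k))
    (W : Submodule k (MvPolynomial (Fin d) k)) [Module.Finite k W]
    (V : Submodule k (MvPolynomial (Fin d) k)) (hV : ∀ f, f ∈ V ↔ f ∈ W ∧ f ∈ K) :
    Module.finrank k (W.map (Ideal.Quotient.mkₐ k K).toLinearMap) + Module.finrank k V =
      Module.finrank k W := by
  have h := ((Ideal.Quotient.mkₐ k K).toLinearMap.domRestrict W).finrank_range_add_finrank_ker
  rw [LinearMap.range_domRestrict] at h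
  rw [← h]
  congr 1
  have hker : V = (LinearMap.ker ((Ideal.Quotient.mkₐ k K).toLinearMap.domRestrict W)).map
      W.subtype := by
    ext f
    rw [hV, Submodule.mem_map]
    constructor
    · rintro ⟨hf, hfK⟩
      exact ⟨⟨f, hf⟩, Ideal.Quotient.eq_zero_iff_mem.2 hfK, rfl⟩
    · rintro ⟨w, hw, rfl⟩
      exact ⟨w.2, Ideal.Quotient.eq_zero_iff_mem.1 hw⟩
  rw [hker]
  exact LinearEquiv.finrank_eq (Submodule.equivMapOfInjective _ W.injective_subtype _).symm

/-- The dimension in degree `n` of the annihilator `(K : x_i) / K` of `x_i` in a section `R / K` is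
the number of leading exponents of `K : x_i` which are not leading exponents of `K`. -/
lemma annihilatorNumber_X {I : Ideal (MvPolynomial (Fin d) k)}
    (hI : I.IsHomogeneous (homogeneousSubmodule (Fin d) k)) (s : Fin d) (n : ℕ) :
    annihilatorNumber I X s n =
      {m ∈ sectionAnnihilatorExps (leadingExps (I : Set (MvPolynomial (Fin d) k))) s.rev |
        m.degree = n}.ncard := by
  set i := s.rev with hi
  set K := sectionIdeal I X i with hK
  rw [annihilatorNumber, ← hi, ← hK, annihilated_inf_quotientDegree]
  have hfg : Module.Finite k (homogeneousSubmodule (Fin d) k n) :=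
    Module.Finite.iff_fg.2 (homogeneousSubmodule_fg (Fin d) k n)
  have hfin : Module.Finite k (colonDegree K (X i) n) :=
    Submodule.finiteDimensional_of_le inf_le_right
  have h := finrank_map_mk_add K (colonDegree K (X i) n) (idealDegree K n) fun f =>
    ⟨fun hf => ⟨⟨K.mul_mem_left _ hf.1, hf.2⟩, hf.1⟩, fun hf => ⟨hf.2, hf.1.2⟩⟩
  rw [finrank_eq_ncard_leadingExps, finrank_eq_ncard_leadingExps, leadingExps_colonDegree hI,
    leadingExps_idealDegree (isHomogeneous_sectionIdeal_X hI i)] at h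
  have hset : {m ∈ sectionAnnihilatorExps (leadingExps (I : Set (MvPolynomial (Fin d) k))) i |
      m.degree = n} =
      {m | m.degree = n ∧ m + Finsupp.single i 1 ∈
        leadingExps (K : Set (MvPolynomial (Fin d) k))} \
      {m ∈ leadingExps (K : Set (MvPolynomial (Fin d) k)) | m.degree = n} := by
    ext m
    simp only [Set.mem_sdiff, Set.mem_ofPred_eq, mem_sectionAnnihilatorExps_iff hI, ← hK]
    tauto
  have hsub : {m ∈ leadingExps (K : Set (MvPolynomial (Fin d) k)) | m.degree = n} ⊆
      {m | m.degree = n ∧ m + Finsupp.single i 1 ∈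
        leadingExps (K : Set (MvPolynomial (Fin d) k))} := fun m hm =>
    ⟨hm.2, isUpperSet_leadingExps K (by simp) hm.1⟩
  rw [hset, Set.ncard_sdiff hsub ((Finsupp.finite_of_degree_eq n).subset fun m hm => hm.2), ← h,
    Nat.add_sub_cancel]

/-- The annihilator of `x_i` in the section `R / K` is spanned by remainders of the division by `K`,
and the leading exponent of such a remainder lies in `sectionAnnihilatorExps`. -/
lemma finite_annihilated_X {I : Ideal (MvPolynomial (Fin d) k)}
    (hI : I.IsHomogeneous (homogeneousSubmodule (Fin d) k)) (i : Fin d)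
    (hfin : (sectionAnnihilatorExps
      (leadingExps (I : Set (MvPolynomial (Fin d) k))) i).Finite) :
    Module.Finite k (annihilated (sectionIdeal I X i) (X i)) := by
  set K := sectionIdeal I X i with hK
  obtain ⟨D, hD⟩ := (hfin.image Finsupp.degree).bddAbove
  have hle : annihilated K (X i) ≤
      (restrictTotalDegree (Fin d) k D).map (Ideal.Quotient.mkₐ k K).toLinearMap := by
    intro y hy
    obtain ⟨p, rfl⟩ := Ideal.Quotient.mk_surjective y
    have hp : Ideal.Quotient.mk K (X i) * Ideal.Quotient.mk K p = 0 := hy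
    rw [← map_mul, Ideal.Quotient.eq_zero_iff_mem] at hp
    obtain ⟨r, hr, hrK⟩ := exists_remainder (K.restrictScalars k) p
    have hpr : Ideal.Quotient.mk K p = Ideal.Quotient.mk K r := Ideal.Quotient.eq.2 hr
    refine ⟨r, ?_, hpr.symm⟩
    by_cases h0 : r = 0
    · rw [h0]
      exact zero_mem _
    obtain ⟨m, hm⟩ := exists_isLeadingMonomial h0
    -- the leading exponent of the remainder bounds its degree
    have hmem : m ∈ sectionAnnihilatorExps
        (leadingExps (I : Set (MvPolynomial (Fin d) k))) i := by
      refine (mem_sectionAnnihilatorExps_iff hI).2 ⟨hrK m hm.1, X i * r, ?_, hm.X_mul i⟩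
      have := K.sub_mem hp (K.mul_mem_left (X i) hr)
      rwa [← mul_sub, sub_sub_cancel] at this
    have hmD : m.degree ≤ D := hD ⟨m, hmem, rfl⟩
    refine (mem_restrictTotalDegree _ _ _).2 (Finset.sup_le fun a ha => ?_)
    change a.degree ≤ D
    rcases hm.eq_or_lt (mem_support_iff.1 ha) with rfl | hlt
    · exact hmD
    · exact hlt.degree_le.trans hmD
  exact Submodule.finiteDimensional_of_le hle

lemma sectionIdeal_map (φ : MvPolynomial (Fin d) k ≃ₐ[k] MvPolynomial (Fin d) k)
    (I : Ideal (MvPolynomial (Fin d) k)) (ℓ : Fin d → MvPolynomial (Fin d) k) (i : Fin d) :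
    sectionIdeal (I.map φ) (fun j => φ (ℓ j)) i = (sectionIdeal I ℓ i).map φ := by
  rw [sectionIdeal, sectionIdeal, Ideal.map_sup, Ideal.map_span, Set.image_image]

/-- The isomorphism of quotients induced by an automorphism of the polynomial ring. -/
noncomputable def quotientMapEquiv (φ : MvPolynomial (Fin d) k ≃ₐ[k] MvPolynomial (Fin d) k)
    (K : Ideal (MvPolynomial (Fin d) k)) :
    (MvPolynomial (Fin d) k ⧸ K) ≃ₗ[k] (MvPolynomial (Fin d) k ⧸ K.map φ) :=
  (Ideal.quotientEquivAlg K (K.map φ) φ rfl).toLinearEquiv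

lemma annihilated_map (φ : MvPolynomial (Fin d) k ≃ₐ[k] MvPolynomial (Fin d) k)
    (K : Ideal (MvPolynomial (Fin d) k)) (f : MvPolynomial (Fin d) k) :
    annihilated (K.map φ) (φ f) =
      (annihilated K f).map (quotientMapEquiv φ K).toLinearMap := by
  set e := Ideal.quotientEquivAlg K (K.map φ) φ rfl with he
  have hmk (x) : e (Ideal.Quotient.mk K x) = Ideal.Quotient.mk (K.map φ) (φ x) := rfl
  ext y
  obtain ⟨x, rfl⟩ := e.surjective y
  have h1 : e x ∈ annihilated (K.map φ) (φ f) ↔ Ideal.Quotient.mk (K.map φ) (φ f) * e x = 0 :=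
    Iff.rfl
  have h2 : x ∈ annihilated K f ↔ Ideal.Quotient.mk K f * x = 0 := Iff.rfl
  rw [h1, ← hmk, ← map_mul, map_eq_zero_iff e e.injective, ← h2]
  constructor
  · exact fun h => ⟨x, h, rfl⟩
  · rintro ⟨x', hx', h⟩
    rwa [← e.injective h]

lemma quotientDegree_map (φ : MvPolynomial (Fin d) k ≃ₐ[k] MvPolynomial (Fin d) k)
    (hφ : ∀ n f, (φ f).IsHomogeneous n ↔ f.IsHomogeneous n)
    (K : Ideal (MvPolynomial (Fin d) k)) (n : ℕ) :
    quotientDegree (K.map φ) n =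
      (quotientDegree K n).map (quotientMapEquiv φ K).toLinearMap := by
  ext y
  constructor
  · rintro ⟨p, hp, rfl⟩
    obtain ⟨q, rfl⟩ := φ.surjective p
    exact ⟨_, ⟨q, (hφ n q).1 hp, rfl⟩, rfl⟩
  · rintro ⟨_, ⟨q, hq, rfl⟩, rfl⟩
    exact ⟨φ q, (hφ n q).2 hq, rfl⟩

lemma isHomogeneous_coordEquiv_iff (g : GL (Fin d) k) (n : ℕ) (f : MvPolynomial (Fin d) k) :
    (coordEquiv g f).IsHomogeneous n ↔ f.IsHomogeneous n := by
  constructor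
  · intro h
    have h' := isHomogeneous_coordChange h g⁻¹
    rwa [show coordChange g⁻¹ (coordEquiv g f) = f from (coordEquiv g).symm_apply_apply f] at h'
  · exact fun h => isHomogeneous_coordChange h g

lemma sectionIdeal_linForm (I : Ideal (MvPolynomial (Fin d) k)) (g : GL (Fin d) k) (i : Fin d) :
    sectionIdeal I (linForm g) i =
      (sectionIdeal (I.map (coordChange g⁻¹)) X i).map (coordEquiv g) := by
  rw [← sectionIdeal_map]
  congr 1
  · exact (map_coordChange_inv g I).symm
  · funext j
    exact (coordChange_X g j).symm

lemma linForm_eq_coordEquiv (g : GL (Fin d) k) (i : Fin d) : linForm g i = coordEquiv g (X i) :=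
  (coordChange_X g i).symm

/-- The annihilator numbers with respect to the rows of `g` are those of `g⁻¹ · I` with respect to
the variables. -/
lemma annihilatorNumber_linForm (I : Ideal (MvPolynomial (Fin d) k)) (g : GL (Fin d) k)
    (s : Fin d) (n : ℕ) :
    annihilatorNumber I (linForm g) s n =
      annihilatorNumber (I.map (coordChange g⁻¹)) X s n := by
  rw [annihilatorNumber, sectionIdeal_linForm, linForm_eq_coordEquiv, annihilated_map,
    quotientDegree_map _ (isHomogeneous_coordEquiv_iff g),
    ← Submodule.map_inf _ (quotientMapEquiv _ _).injective]
  exact LinearEquiv.finrank_map_eq (quotientMapEquiv _ _) _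

lemma isAlmostRegular_linForm {I : Ideal (MvPolynomial (Fin d) k)} {g : GL (Fin d) k}
    (h : IsAlmostRegular (I.map (coordChange g⁻¹)) X) : IsAlmostRegular I (linForm g) := by
  intro i
  have := h i
  rw [sectionIdeal_linForm, linForm_eq_coordEquiv, annihilated_map]
  infer_instance

/-- If the generic initial ideal has finitely many monomials annihilated by `x_i` in the `i`-th
section, for each `i`, these monomials are counted by the generic annihilator numbers. -/
lemma genericAnnihilatorNumber_eq_ncard [Infinite k] {I : Ideal (MvPolynomial (Fin d) k)}
    (hI : I.IsHomogeneous (homogeneousSubmodule (Fin d) k))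
    (hfin : ∀ i, (sectionAnnihilatorExps (ginExps I) i).Finite) (s : Fin d) (n : ℕ) :
    genericAnnihilatorNumber I s n =
      {m ∈ sectionAnnihilatorExps (ginExps I) s.rev | m.degree = n}.ncard := by
  classical
  have hgen : AreGenericAnnihilatorNumbers I fun s n =>
      {m ∈ sectionAnnihilatorExps (ginExps I) s.rev | m.degree = n}.ncard := by
    refine (generic_leadingExps_eq_ginExps hI).inv.mono fun g hg => ⟨?_, fun s n => ?_⟩
    · refine isAlmostRegular_linForm fun i =>
        finite_annihilated_X (isHomogeneous_map_coordChange hI _) i ?_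
      rw [hg]
      exact hfin i
    · rw [annihilatorNumber_linForm, annihilatorNumber_X (isHomogeneous_map_coordChange hI _), hg]
  have hex : ∃ α, AreGenericAnnihilatorNumbers I α := ⟨_, hgen⟩
  rw [genericAnnihilatorNumber, dif_pos hex]
  obtain ⟨g, hg⟩ := (HoldsGenerically.and hex.choose_spec hgen).exists
  rw [← hg.1.2 s n, hg.2.2 s n]

end

section

/-! ### Heights of prime ideals in polynomial rings -/

/-- By induction on the number of variables: as polynomial rings over fields are Jacobson rings, `M`
lies over a maximal ideal of the polynomial ring in one variable less. -/
lemma height_of_isMaximal_mvPolynomial {K : Type*} [Field K] {α : Type*} [Finite α]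
    (M : Ideal (MvPolynomial α K)) (hM : M.IsMaximal) : M.height = (Nat.card α : ℕ∞) := by
  induction α using Finite.induction_empty_option with
  | of_equiv e ih =>
    rw [← Nat.card_congr e]
    have h := (renameEquiv K e).toRingEquiv.height_comap M
    rw [← h]
    exact ih _ (Ideal.comap_isMaximal_of_equiv (renameEquiv K e).toRingEquiv)
  | h_empty =>
    have h := Ideal.height_le_ringKrullDim_of_ne_top hM.ne_top
    rw [MvPolynomial.ringKrullDim_of_isNoetherianRing, ringKrullDim_eq_zero_of_field] at h
    simpa using h
  | @h_option α _ ih =>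
    let e := (optionEquivLeft K α).toRingEquiv.symm
    have h := e.height_comap M
    have hM' : (M.comap e).IsMaximal := Ideal.comap_isMaximal_of_equiv e
    have hp := Polynomial.isMaximal_comap_C_of_isJacobsonRing (M.comap e)
    have hlies : (M.comap e).LiesOver ((M.comap e).comap Polynomial.C) := ⟨rfl⟩
    rw [← h, Polynomial.height_eq_height_add_one ((M.comap e).comap Polynomial.C) (M.comap e),
      ih _ hp, Nat.card_eq_fintype_card, Nat.card_eq_fintype_card, Fintype.card_option]
    norm_cast

lemma isIntegral_of_isIntegral_X {K B α : Type*} [CommRing K] [CommRing B] [Algebra K B]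
    (φ : MvPolynomial α K →ₐ[K] B) (hφ : Function.Surjective φ)
    (h : ∀ j, IsIntegral K (φ (X j))) : Algebra.IsIntegral K B := by
  constructor
  intro y
  obtain ⟨p, rfl⟩ := hφ y
  induction p using MvPolynomial.induction_on with
  | C a =>
    rw [algHom_C]
    exact isIntegral_algebraMap
  | add p q hp hq =>
    rw [map_add]
    exact hp.add hq
  | mul_X p j hp =>
    rw [map_mul]
    exact hp.mul (h j)

/-- A prime ideal of a polynomial ring over a field is maximal if the variables are algebraic
modulo it. -/
lemma isMaximal_of_isAlgebraic_X {K α : Type*} [Field K] (Q : Ideal (MvPolynomial α K)) [Q.IsPrime]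
    (h : ∀ j, ∃ f : Polynomial K, f ≠ 0 ∧ f.eval₂ C (X j) ∈ Q) : Q.IsMaximal := by
  have hint := isIntegral_of_isIntegral_X (Ideal.Quotient.mkₐ K Q)
    Ideal.Quotient.mk_surjective fun j => by
      obtain ⟨f, hf0, hf⟩ := h j
      refine isAlgebraic_iff_isIntegral.1 ⟨f, hf0, ?_⟩
      rw [← Ideal.Quotient.eq_zero_iff_mem, Polynomial.hom_eval₂] at hf
      exact hf
  exact Ideal.Quotient.maximal_of_isField _
    (isField_of_isIntegral_of_isField' (Field.toIsField K))

section Localization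

attribute [local instance] MvPolynomial.algebraMvPolynomial

variable {A : Type*} [CommRing A] [IsDomain A] {α : Type*} (Q : Ideal (MvPolynomial α A))

lemma disjoint_map_C_nonZeroDivisors (hQ : ∀ a, C a ∈ Q → a = 0) :
    Disjoint ((nonZeroDivisors A).map (C (σ := α)) : Set (MvPolynomial α A))
      (Q : Set (MvPolynomial α A)) := by
  rw [Set.disjoint_left]
  rintro _ ⟨a, ha, rfl⟩ haQ
  exact nonZeroDivisors.ne_zero ha (hQ a haQ)

variable [Finite α] [Q.IsPrime]

/-- A prime ideal meeting the coefficient domain in zero survives in the polynomial ring over the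
fraction field. -/
lemma height_le_of_comap_C_eq_bot [IsNoetherianRing A] (hQ : ∀ a, C a ∈ Q → a = 0) :
    Q.height ≤ (Nat.card α : ℕ∞) := by
  let K := FractionRing A
  have hdis := disjoint_map_C_nonZeroDivisors Q hQ
  rw [← IsLocalization.height_map_of_disjoint (S := MvPolynomial α K)
    ((nonZeroDivisors A).map (C (σ := α))) Q hdis]
  have hprime := IsLocalization.isPrime_of_isPrime_disjoint
    ((nonZeroDivisors A).map (C (σ := α))) (MvPolynomial α K) Q ‹_› hdis
  have h := Ideal.height_le_ringKrullDim_of_ne_top hprime.ne_top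
  rw [MvPolynomial.ringKrullDim_of_isNoetherianRing, ringKrullDim_eq_zero_of_field, zero_add] at h
  exact_mod_cast h

/-- If moreover the variables are algebraic over the coefficient domain modulo `Q`, then `Q` extends
to a maximal ideal of the polynomial ring over the fraction field. -/
lemma height_eq_of_comap_C_eq_bot (hQ : ∀ a, C a ∈ Q → a = 0)
    (halg : ∀ j, ∃ f : Polynomial A, f ≠ 0 ∧ f.eval₂ C (X j) ∈ Q) :
    Q.height = (Nat.card α : ℕ∞) := by
  let K := FractionRing A
  have hdis := disjoint_map_C_nonZeroDivisors Q hQ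
  rw [← IsLocalization.height_map_of_disjoint (S := MvPolynomial α K)
    ((nonZeroDivisors A).map (C (σ := α))) Q hdis]
  set Q' := Q.map (algebraMap (MvPolynomial α A) (MvPolynomial α K)) with hQ'
  have hprime : Q'.IsPrime := IsLocalization.isPrime_of_isPrime_disjoint
    ((nonZeroDivisors A).map (C (σ := α))) (MvPolynomial α K) Q ‹_› hdis
  refine height_of_isMaximal_mvPolynomial Q' (isMaximal_of_isAlgebraic_X Q' fun j => ?_)
  obtain ⟨f, hf0, hf⟩ := halg j
  refine ⟨f.map (algebraMap A K),
    (Polynomial.map_ne_zero_iff (IsFractionRing.injective A K)).2 hf0, ?_⟩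
  have h1 : map (algebraMap A K) (f.eval₂ C (X j)) ∈ Q' := by
    rw [← algebraMap_def]
    exact Ideal.mem_map_of_mem _ hf
  rw [Polynomial.hom_eval₂, map_X] at h1
  have h2 : (map (algebraMap A K)).comp C =
      (C (σ := α) : K →+* _).comp (algebraMap A K) := by
    ext a
    simp
  rwa [h2, ← Polynomial.eval₂_map] at h1

end Localization

variable {k : Type*} [Field k] {σ : Type*}

/-- Polynomials in the variables outside `S` over the polynomials in the variables in `S`. -/
noncomputable def splitEquiv (S : Set σ) :
    MvPolynomial σ k ≃+* MvPolynomial ↥Sᶜ (MvPolynomial S k) := by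
  classical
  exact ((renameEquiv k ((Equiv.Set.sumCompl S).symm.trans (Equiv.sumComm _ _))).trans
    (sumAlgEquiv k ↥Sᶜ S)).toRingEquiv

lemma splitEquiv_X_of_notMem (S : Set σ) (j : ↥Sᶜ) :
    splitEquiv S (X (R := k) j.1) = X j := by
  classical
  simp [splitEquiv, Equiv.Set.sumCompl_symm_apply_of_notMem j.2]

lemma splitEquiv_rename (S : Set σ) (a : MvPolynomial S k) :
    splitEquiv S (rename Subtype.val a) = C a := by
  classical
  have h : (splitEquiv (k := k) S).toRingHom.comp
      (rename Subtype.val : MvPolynomial S k →ₐ[k] MvPolynomial σ k).toRingHom = C := by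
    refine MvPolynomial.ringHom_ext (fun r => ?_) fun i => ?_
    · simp [splitEquiv]
    · simp [splitEquiv, Equiv.Set.sumCompl_symm_apply_of_mem i.2]
  exact RingHom.congr_fun h a

lemma rename_mem_iff_C_mem (P : Ideal (MvPolynomial σ k)) (S : Set σ) (a : MvPolynomial S k) :
    C a ∈ P.comap (splitEquiv S).symm ↔ rename Subtype.val a ∈ P := by
  rw [Ideal.mem_comap, ← splitEquiv_rename, RingEquiv.symm_apply_apply]

variable [Finite σ]

/-- A prime ideal containing no nonzero polynomial in the variables in `S` has height at most the
number of the other variables. -/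
lemma height_le_card_compl (P : Ideal (MvPolynomial σ k)) [P.IsPrime] (S : Set σ)
    (hS : ∀ a : MvPolynomial S k, rename Subtype.val a ∈ P → a = 0) :
    P.height ≤ (Nat.card ↥Sᶜ : ℕ∞) := by
  rw [← (splitEquiv S).symm.height_comap P]
  have : (P.comap (splitEquiv (k := k) S).symm).IsPrime := Ideal.comap_isPrime _ _
  exact height_le_of_comap_C_eq_bot _ fun a ha => hS a ((rename_mem_iff_C_mem P S a).1 ha)

lemma height_eq_card_compl (P : Ideal (MvPolynomial σ k)) [P.IsPrime] (S : Set σ)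
    (hS : ∀ a : MvPolynomial S k, rename Subtype.val a ∈ P → a = 0)
    (halg : ∀ j ∉ S, ∃ f : Polynomial (MvPolynomial S k), f ≠ 0 ∧
      f.eval₂ (rename Subtype.val : MvPolynomial S k →ₐ[k] MvPolynomial σ k).toRingHom (X j) ∈ P) :
    P.height = (Nat.card ↥Sᶜ : ℕ∞) := by
  rw [← (splitEquiv S).symm.height_comap P]
  have : (P.comap (splitEquiv (k := k) S).symm).IsPrime := Ideal.comap_isPrime _ _
  refine height_eq_of_comap_C_eq_bot _ (fun a ha => hS a ((rename_mem_iff_C_mem P S a).1 ha))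
    fun j => ?_
  obtain ⟨f, hf0, hf⟩ := halg j.1 j.2
  refine ⟨f, hf0, ?_⟩
  rw [Ideal.mem_comap]
  convert hf
  rw [← RingEquiv.eq_symm_apply, RingEquiv.symm_symm]
  change _ = (splitEquiv (k := k) S).toRingHom _
  rw [Polynomial.hom_eval₂]
  congr 1
  · exact RingHom.ext fun a => (splitEquiv_rename S a).symm
  · exact (splitEquiv_X_of_notMem S j).symm

/-- If `R / P` has dimension at most `n`, then `P` has height at least `dim R - n`. Modulo `P`, all
variables are algebraic over the fraction field of the polynomials in a transcendence basis
consisting of variables, so that the height of `P` is the number of the other variables. -/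
lemma card_le_height_add (P : Ideal (MvPolynomial σ k)) [P.IsPrime] {n : ℕ}
    (hn : Algebra.trdeg k (MvPolynomial σ k ⧸ P) ≤ n) :
    (Nat.card σ : ℕ∞) ≤ P.height + n := by
  classical
  let x : σ → MvPolynomial σ k ⧸ P := fun j => Ideal.Quotient.mk P (X j)
  obtain ⟨S, hS, hmax⟩ : ∃ S : Set σ, AlgebraicIndepOn k x S ∧
      ∀ j ∉ S, ¬ AlgebraicIndepOn k x (insert j S) := by
    obtain ⟨S, hS⟩ := (Set.toFinite {S : Set σ | AlgebraicIndepOn k x S}).exists_maximal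
      ⟨∅, by
        refine (algebraicIndependent_empty_type_iff (R := k) ..).2 ?_
        exact (algebraMap k _).injective⟩
    refine ⟨S, hS.prop, fun j hj hins => hj ?_⟩
    exact hS.le_of_ge hins (Set.subset_insert j S) (Set.mem_insert j S)
  have hmk (a : MvPolynomial S k) : Ideal.Quotient.mk P (rename Subtype.val a) =
      aeval (fun i : S => x i) a := by
    have : (Ideal.Quotient.mkₐ k P).comp (rename Subtype.val) = aeval (fun i : S => x i) := by
      ext i
      simp [x]
    exact AlgHom.congr_fun this a
  have hheight : P.height = (Nat.card ↥Sᶜ : ℕ∞) := by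
    refine height_eq_card_compl P S (fun a ha => ?_) fun j hj => ?_
    · rw [← Ideal.Quotient.eq_zero_iff_mem, hmk] at ha
      exact hS.eq_zero_of_aeval_eq_zero a ha
    · have halg : IsAlgebraic (Algebra.adjoin k (x '' S)) (x j) := by
        by_contra h
        exact hmax j hj (hS.insert h)
      obtain ⟨p, hp0, hp⟩ := halg
      let ψ := hS.aevalEquiv
      refine ⟨p.map ψ.symm.toRingEquiv.toRingHom, ?_, ?_⟩
      · exact (Polynomial.map_ne_zero_iff ψ.symm.injective).2 hp0
      · rw [← Ideal.Quotient.eq_zero_iff_mem, Polynomial.hom_eval₂, Polynomial.eval₂_map]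
        refine Eq.trans ?_ hp
        rw [Polynomial.aeval_def]
        congr 1
        refine RingHom.ext fun b => ?_
        change Ideal.Quotient.mk P (rename Subtype.val (ψ.symm b)) = b
        rw [hmk]
        have := hS.algebraMap_aevalEquiv (ψ.symm b)
        rw [← this]
        exact congrArg Subtype.val (ψ.apply_symm_apply b)
  have hSn : Nat.card S ≤ n := by
    have h1 := AlgebraicIndependent.lift_cardinalMk_le_trdeg hS
    have h2 := h1.trans (Cardinal.lift_le.2 hn)
    rw [Cardinal.lift_natCast, Cardinal.lift_le_nat_iff, ← Nat.cast_card] at h2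
    exact_mod_cast h2
  rw [hheight]
  have hcard : Nat.card S + Nat.card ↥Sᶜ = Nat.card σ := by
    rw [← Nat.card_sum, Nat.card_congr (Equiv.Set.sumCompl S)]
  rw [← hcard]
  norm_cast
  omega

end

section

variable {d : ℕ} {k : Type*} [Field k]

/-! ### The height of an ideal and its leading exponents -/

/-- If every leading exponent of `I` involves a variable outside `S`, then `I` contains no nonzero
polynomial in the variables in `S`, and neither does some prime ideal above `I`. -/
lemma height_le_of_leadingExps (I : Ideal (MvPolynomial (Fin d) k)) (S : Set (Fin d))
    (hS : ∀ m ∈ leadingExps (I : Set (MvPolynomial (Fin d) k)), ∃ j ∉ S, m j ≠ 0) :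
    I.height ≤ (Nat.card ↥Sᶜ : ℕ∞) := by
  classical
  let M : Submonoid (MvPolynomial (Fin d) k) :=
    (nonZeroDivisors (MvPolynomial S k)).map (rename Subtype.val : MvPolynomial S k →ₐ[k] _)
  have hdis : Disjoint (I : Set (MvPolynomial (Fin d) k)) M := by
    rw [Set.disjoint_left]
    rintro _ hI ⟨a, ha, rfl⟩
    have h0 : rename Subtype.val a ≠ (0 : MvPolynomial (Fin d) k) := by
      rw [Ne, map_eq_zero_iff _ (rename_injective _ Subtype.val_injective)]
      exact nonZeroDivisors.ne_zero ha
    obtain ⟨m, hm⟩ := exists_isLeadingMonomial h0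
    obtain ⟨j, hj, hmj⟩ := hS m ⟨_, hI, hm⟩
    obtain ⟨u, rfl, -⟩ := coeff_rename_ne_zero _ _ _ hm.coeff_ne_zero
    refine hmj (Finsupp.mapDomain_of_notMem_range _ _ ?_)
    rwa [Subtype.range_val]
  obtain ⟨P, hP, hIP, hPM⟩ := Ideal.exists_le_prime_disjoint I M hdis
  refine (Ideal.height_mono hIP).trans (height_le_card_compl P S fun a ha => ?_)
  by_contra h0
  exact Set.disjoint_left.1 hPM ha ⟨a, mem_nonZeroDivisors_of_ne_zero h0, rfl⟩

/-- If `I` has leading exponents which are powers of each variable outside `S`, then `R / P` is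
finite over the subalgebra generated by the variables in `S`, for all `P ⊇ I`: the remainders of the
division by `I` have bounded exponents outside `S`. -/
lemma trdeg_quotient_le (I P : Ideal (MvPolynomial (Fin d) k)) [P.IsPrime] (hIP : I ≤ P)
    (S : Set (Fin d)) (hS : ∀ j ∉ S, ∃ n : ℕ,
      Finsupp.single j n ∈ leadingExps (I : Set (MvPolynomial (Fin d) k))) :
    Algebra.trdeg k (MvPolynomial (Fin d) k ⧸ P) ≤ (Nat.card S : ℕ) := by
  classical
  let x : Fin d → MvPolynomial (Fin d) k ⧸ P := fun j => Ideal.Quotient.mk P (X j)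
  choose! n hn using hS
  let bound : Fin d →₀ ℕ := Finsupp.equivFunOnFinite.symm n
  have hfin : Module.Finite (Algebra.adjoin k (x '' S)) (MvPolynomial (Fin d) k ⧸ P) := by
    refine ⟨⟨((Set.finite_Iic bound).image
      fun m => Ideal.Quotient.mk P (monomial m 1)).toFinset, ?_⟩⟩
    rw [Set.Finite.coe_toFinset, eq_top_iff]
    rintro y -
    obtain ⟨f, rfl⟩ := Ideal.Quotient.mk_surjective y
    obtain ⟨r, hr, hrI⟩ := exists_remainder (I.restrictScalars k) f
    rw [show Ideal.Quotient.mk P f = Ideal.Quotient.mk P r from Ideal.Quotient.eq.2 (hIP hr),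
      r.as_sum, map_sum]
    refine Submodule.sum_mem _ fun m hm => ?_
    have hsplit : monomial m (coeff m r) = monomial (m.filter (· ∈ S)) (coeff m r) *
        monomial (m.filter fun j => ¬ j ∈ S) 1 := by
      rw [monomial_mul, mul_one, Finsupp.filter_add_filter_not]
    have hB : Ideal.Quotient.mk P (monomial (m.filter (· ∈ S)) (coeff m r)) ∈
        Algebra.adjoin k (x '' S) := by
      rw [monomial_eq, map_mul, Finsupp.prod, map_prod]
      refine mul_mem (Subalgebra.algebraMap_mem _ _) (prod_mem fun j hj => ?_)
      rw [map_pow]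
      rw [Finsupp.support_filter, Finset.mem_filter] at hj
      have hx : x j ∈ Algebra.adjoin k (x '' S) := Algebra.subset_adjoin ⟨j, hj.2, rfl⟩
      exact pow_mem hx _
    have hle : m.filter (fun j => ¬ j ∈ S) ≤ bound := by
      intro j
      rw [Finsupp.filter_apply]
      split_ifs with hj
      · exact Nat.zero_le _
      · change m j ≤ n j
        by_contra hlt
        refine hrI m hm (isUpperSet_leadingExps I ?_ (hn j hj))
        rw [Finsupp.single_le_iff]
        omega
    rw [hsplit, map_mul]
    exact Submodule.smul_mem (Submodule.span (Algebra.adjoin k (x '' S))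
      ((fun m => Ideal.Quotient.mk P (monomial m 1)) '' Set.Iic bound))
      (⟨_, hB⟩ : Algebra.adjoin k (x '' S)) (Submodule.subset_span ⟨_, hle, rfl⟩)
  have halg : Algebra.IsAlgebraic (Algebra.adjoin k (x '' S)) (MvPolynomial (Fin d) k ⧸ P) :=
    inferInstance
  refine (Algebra.IsAlgebraic.trdeg_le_cardinalMk k (x '' S)).trans ?_
  have hle : Nat.card (x '' S) ≤ Nat.card S := Nat.card_image_le S.toFinite
  rw [← Nat.cast_card]
  exact_mod_cast hle

/-- The height is at least the number of variables with a power among the leading monomials, by the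
dimension formula for the minimal primes of `I`. -/
lemma le_height_of_leadingExps (I : Ideal (MvPolynomial (Fin d) k)) (S : Set (Fin d))
    (hS : ∀ j ∉ S, ∃ n : ℕ,
      Finsupp.single j n ∈ leadingExps (I : Set (MvPolynomial (Fin d) k))) :
    (Nat.card ↥Sᶜ : ℕ∞) ≤ I.height := by
  classical
  rw [Ideal.height_eq_inf_minimalPrimes]
  refine le_iInf₂ fun P hP => ?_
  have hprime := hP.isPrime
  have h := card_le_height_add P (trdeg_quotient_le I P hP.1.2 S hS)
  have hcard : Nat.card S + Nat.card ↥Sᶜ = Nat.card (Fin d) := by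
    rw [← Nat.card_sum, Nat.card_congr (Equiv.Set.sumCompl S)]
  rw [← hcard, Nat.cast_add, add_comm] at h
  exact (ENat.add_le_add_iff_right (ENat.natCast_ne_top _)).1 h

/-! ### Strongly stable sets of exponents -/

/-- Replacing all variables after the `t`-th by the `t`-th one stays in a strongly stable set. -/
lemma add_single_degree_mem {N : Set (Fin d →₀ ℕ)}
    (hN : ∀ i j : Fin d, i < j → ∀ m, m + Finsupp.single j 1 ∈ N → m + Finsupp.single i 1 ∈ N)
    (t : Fin d) (a : Fin d →₀ ℕ) (ha : ∀ j, a j ≠ 0 → t ≤ j) (m : Fin d →₀ ℕ) (hm : m + a ∈ N) :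
    m + Finsupp.single t a.degree ∈ N := by
  induction hn : a.degree generalizing a m with
  | zero =>
    rw [(Finsupp.degree_eq_zero_iff a).1 hn] at hm
    simpa using hm
  | succ n ih =>
    obtain ⟨j, hj⟩ : ∃ j, a j ≠ 0 := by
      by_contra! h
      rw [show a = 0 from Finsupp.ext h] at hn
      simp at hn
    obtain ⟨b, rfl⟩ := exists_add_of_le (Finsupp.single_le_iff.2 (Nat.one_le_iff_ne_zero.2 hj))
    have hb : b.degree = n := by
      rw [map_add, Finsupp.degree_single] at hn
      omega
    have h1 := ih b (fun l hl => ha l (by rw [Finsupp.add_apply]; omega))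
      (m + Finsupp.single j 1) (by rwa [add_assoc]) hb
    have h2 : m + Finsupp.single t n + Finsupp.single t 1 ∈ N := by
      have h3 : m + Finsupp.single t n + Finsupp.single j 1 ∈ N := by
        convert h1 using 1
        abel
      rcases (ha j hj).eq_or_lt with rfl | hlt
      · exact h3
      · exact hN t j hlt _ h3
    rwa [add_assoc, ← Finsupp.single_add] at h2

/-- Replacing powers of the `t`-th variable by earlier variables stays in a strongly stable set. -/
lemma add_mem_of_single_degree_mem {N : Set (Fin d →₀ ℕ)}
    (hN : ∀ i j : Fin d, i < j → ∀ m, m + Finsupp.single j 1 ∈ N → m + Finsupp.single i 1 ∈ N)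
    (t : Fin d) (a : Fin d →₀ ℕ) (ha : ∀ j, a j ≠ 0 → j ≤ t) (m : Fin d →₀ ℕ)
    (hm : m + Finsupp.single t a.degree ∈ N) : m + a ∈ N := by
  induction hn : a.degree generalizing a m with
  | zero =>
    rw [(Finsupp.degree_eq_zero_iff a).1 hn] at hm ⊢
    simpa using hm
  | succ n ih =>
    obtain ⟨j, hj⟩ : ∃ j, a j ≠ 0 := by
      by_contra! h
      rw [show a = 0 from Finsupp.ext h] at hn
      simp at hn
    obtain ⟨b, rfl⟩ := exists_add_of_le (Finsupp.single_le_iff.2 (Nat.one_le_iff_ne_zero.2 hj))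
    have hb : b.degree = n := by
      rw [map_add, Finsupp.degree_single] at hn
      omega
    rw [← add_assoc]
    refine ih b (fun l hl => ha l (by rw [Finsupp.add_apply]; omega)) _ ?_ hb
    have h3 : m + Finsupp.single t n + Finsupp.single t 1 ∈ N := by
      rwa [add_assoc, ← Finsupp.single_add, ← hn]
    have h4 : m + Finsupp.single t n + Finsupp.single j 1 ∈ N := by
      rcases (ha j hj).eq_or_lt with rfl | hlt
      · exact h3
      · exact hN j t hlt _ h3
    rw [hb]
    convert h4 using 1
    abel

/-- For a strongly stable set `N` of exponents, adding `e_i` to an element of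
`sectionAnnihilatorExps N i` gives a minimal element of `N`. -/
lemma minimal_add_single {N : Set (Fin d →₀ ℕ)} (hup : IsUpperSet N)
    (hN : ∀ i j : Fin d, i < j → ∀ m, m + Finsupp.single j 1 ∈ N → m + Finsupp.single i 1 ∈ N)
    {i : Fin d} {m : Fin d →₀ ℕ} (hm : m ∈ sectionAnnihilatorExps N i) :
    Minimal (· ∈ N) (m + Finsupp.single i 1) := by
  obtain ⟨h1, h2, h3⟩ := hm
  refine ⟨h3, fun b hb hle => ?_⟩
  by_contra hnle
  obtain ⟨j, hj⟩ : ∃ j, b j < (m + Finsupp.single i 1 : Fin d →₀ ℕ) j := by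
    by_contra! h
    exact hnle h
  -- so `b` divides the quotient of `m + e_i` by the `j`-th variable
  obtain ⟨c, hc⟩ := exists_add_of_le
    (Finsupp.single_le_iff.2 (show 1 ≤ (m + Finsupp.single i 1 : Fin d →₀ ℕ) j by omega))
  have hbc : b ≤ c := by
    intro l
    have hl := hle l
    rw [hc, Finsupp.add_apply] at hl
    by_cases h : l = j
    · subst h
      rw [hc, Finsupp.add_apply, Finsupp.single_eq_same] at hj
      omega
    · rwa [Finsupp.single_eq_of_ne h, zero_add] at hl
  have hcN := hup hbc hb
  have hji : j ≤ i := by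
    by_contra! h
    rw [Finsupp.add_apply, h1 j h, Finsupp.single_eq_of_ne h.ne'] at hj
    omega
  rcases hji.eq_or_lt with rfl | hlt
  · rw [add_comm] at hc
    exact h2 (add_left_cancel hc ▸ hcN)
  · have hmj : Finsupp.single j 1 ≤ m := by
      rw [Finsupp.single_le_iff]
      rw [Finsupp.add_apply, Finsupp.single_eq_of_ne hlt.ne] at hj
      omega
    obtain ⟨u, rfl⟩ := exists_add_of_le hmj
    rw [add_assoc] at hc
    rw [← add_left_cancel hc] at hcN
    exact h2 (add_comm u _ ▸ hN j i hlt u hcN)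

lemma finite_sectionAnnihilatorExps {N : Set (Fin d →₀ ℕ)} (hup : IsUpperSet N)
    (hN : ∀ i j : Fin d, i < j → ∀ m, m + Finsupp.single j 1 ∈ N → m + Finsupp.single i 1 ∈ N)
    (i : Fin d) : (sectionAnnihilatorExps N i).Finite := by
  have hmin : {m | Minimal (· ∈ N) m}.Finite :=
    WellQuasiOrderedLE.finite_of_isAntichain (setOfPred_minimal_antichain _)
  exact Set.Finite.of_finite_image (f := (· + Finsupp.single i 1))
    (hmin.subset (by
      rintro _ ⟨m, hm, rfl⟩
      exact minimal_add_single hup hN hm)) (add_left_injective _).injOn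

/-! ### Axial constants and coextremal annihilator numbers -/

lemma isUpperSet_ginExps (I : Ideal (MvPolynomial (Fin d) k)) : IsUpperSet (ginExps I) := by
  rintro m m' h hm
  obtain ⟨a, rfl⟩ := exists_add_of_le h
  change monomial (m + a) (1 : k) ∈ ginRev I
  rw [← one_mul (1 : k), ← monomial_mul]
  exact Ideal.mul_mem_right _ _ hm

lemma ginExps_add_single {I : Ideal (MvPolynomial (Fin d) k)} (h : IsStronglyStable (ginRev I))
    (i j : Fin d) (hij : i < j) (m : Fin d →₀ ℕ) (hm : m + Finsupp.single j 1 ∈ ginExps I) :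
    m + Finsupp.single i 1 ∈ ginExps I := by
  have key (l : Fin d) : monomial m (1 : k) * X l = monomial (m + Finsupp.single l 1) 1 := by
    rw [X, monomial_mul, one_mul]
  change monomial _ (1 : k) ∈ ginRev I at hm ⊢
  rw [← key] at hm ⊢
  exact h.2 i j hij m hm

lemma zero_notMem_leadingExps {I : Ideal (MvPolynomial (Fin d) k)} (hI : I ≠ ⊤) :
    0 ∉ leadingExps (I : Set (MvPolynomial (Fin d) k)) := by
  rintro ⟨f, hf, h0⟩
  have hfC : f = C (coeff 0 f) := by
    ext m
    rw [coeff_C]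
    split_ifs with h
    · rw [h]
    · by_contra hne
      rcases h0.eq_or_lt hne with e | hlt
      · exact h e.symm
      · have := hlt.degree_le
        rw [map_zero, Nat.le_zero, Finsupp.degree_eq_zero_iff] at this
        exact h this.symm
  refine hI (Ideal.eq_top_of_isUnit_mem _ hf ?_)
  rw [hfC]
  exact (isUnit_iff_ne_zero.2 h0.coeff_ne_zero).map C

/-- The powers of `x_i` in the generic initial ideal of an ideal of height `c`: there are some
exactly for the first `c` variables. -/
lemma exists_single_mem_ginExps_iff [Infinite k] {I : Ideal (MvPolynomial (Fin d) k)}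
    (hI : I.IsHomogeneous (homogeneousSubmodule (Fin d) k)) (hI_top : I ≠ ⊤) {c : ℕ}
    (hc : I.height = (c : ℕ∞)) (h : IsStronglyStable (ginRev I)) :
    c ≤ d ∧ ∀ j : Fin d, (∃ n : ℕ, Finsupp.single j n ∈ ginExps I) ↔ (j : ℕ) < c := by
  obtain ⟨g, hg⟩ := (generic_leadingExps_eq_ginExps hI).exists
  have hstab := ginExps_add_single h
  have h0 : 0 ∉ ginExps I := hg ▸ zero_notMem_leadingExps (map_coordChange_ne_top hI_top)
  let S : Set (Fin d) := {j | ∀ n : ℕ, Finsupp.single j n ∉ ginExps I}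
  have hle : (Nat.card ↥Sᶜ : ℕ∞) ≤ c := by
    rw [← hc, ← height_map_coordChange g I]
    refine le_height_of_leadingExps _ S fun j hj => ?_
    rw [hg]
    simpa [S] using hj
  have hge : (c : ℕ∞) ≤ Nat.card ↥Sᶜ := by
    rw [← hc, ← height_map_coordChange g I]
    refine height_le_of_leadingExps _ S fun m hm => ?_
    rw [hg] at hm
    -- otherwise a power of the first variable of `m` is in the initial ideal
    by_contra! hmS
    have hm0 : m.support.Nonempty := by
      rw [Finsupp.support_nonempty_iff]
      rintro rfl
      exact h0 hm
    obtain ⟨t, ht, hmin⟩ := m.support.exists_min_image id hm0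
    have htS : t ∈ S := by
      by_contra htS
      exact Finsupp.mem_support_iff.1 ht (hmS t htS)
    refine htS m.degree ?_
    have := add_single_degree_mem hstab t m
      (fun j hj => hmin j (Finsupp.mem_support_iff.2 hj)) 0 (by rwa [zero_add])
    rwa [zero_add] at this
  have hcard : (Sᶜ).ncard = c := by
    have := le_antisymm hle hge
    rw [Nat.card_coe_set_eq] at this
    exact_mod_cast this
  have hlower {i j : Fin d} (hij : i ≤ j) (hj : j ∈ Sᶜ) : i ∈ Sᶜ := by
    simp only [S, Set.mem_compl_iff, Set.mem_ofPred_eq, not_forall, not_not] at hj ⊢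
    obtain ⟨n, hn⟩ := hj
    refine ⟨n, ?_⟩
    have := add_single_degree_mem hstab i (Finsupp.single j n) (fun l hl => ?_) 0
      (by rwa [zero_add])
    · rwa [zero_add, Finsupp.degree_single] at this
    · rw [Finsupp.single_apply_ne_zero] at hl
      rwa [hl.1]
  constructor
  · rw [← hcard]
    exact (Set.ncard_le_card _).trans (by simp)
  · intro j
    have hmem : (∃ n : ℕ, Finsupp.single j n ∈ ginExps I) ↔ j ∈ Sᶜ := by simp [S]
    rw [hmem, ← hcard]
    constructor
    · intro hj
      have h1 : (Set.Iic j).ncard ≤ (Sᶜ).ncard :=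
        Set.ncard_le_ncard (fun i hi => hlower hi hj) (Set.toFinite _)
      rw [Set.ncard_eq_toFinset_card' (Set.Iic j), Set.toFinset_Iic, Fin.card_Iic] at h1
      omega
    · intro hlt
      by_contra hj
      have h1 : (Sᶜ).ncard ≤ (Set.Iio j).ncard :=
        Set.ncard_le_ncard (fun i hi => lt_of_not_ge fun hji => hj (hlower hji hi))
          (Set.toFinite _)
      rw [Set.ncard_eq_toFinset_card' (Set.Iio j), Set.toFinset_Iio, Fin.card_Iio] at h1
      omega

lemma axialConstant_succ (I : Ideal (MvPolynomial (Fin d) k)) (i : Fin d) :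
    axialConstant I (i + 1) =
      ((⨅ (n : ℕ) (_ : Finsupp.single i n ∈ ginExps I), (n : ℕ∞) : ℕ∞) : WithBot ℕ∞) := by
  rw [axialConstant, dif_pos i.2]
  simp only [Fin.eta, X_pow_eq_monomial]
  rfl

lemma axialConstant_succ_eq_coe {I : Ideal (MvPolynomial (Fin d) k)} {i : Fin d} {p : ℕ}
    (hp : ∀ n, Finsupp.single i n ∈ ginExps I ↔ p ≤ n) :
    axialConstant I (i + 1) = ((p : ℕ) : WithBot ℕ∞) := by
  rw [axialConstant_succ]
  have : (⨅ (n : ℕ) (_ : Finsupp.single i n ∈ ginExps I), (n : ℕ∞)) = (p : ℕ∞) :=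
    le_antisymm (iInf₂_le p ((hp p).2 le_rfl)) (le_iInf₂ fun n hn => by exact_mod_cast (hp n).1 hn)
  rw [this]
  rfl

lemma axialConstant_succ_eq_top {I : Ideal (MvPolynomial (Fin d) k)} {i : Fin d}
    (hp : ∀ n : ℕ, Finsupp.single i n ∉ ginExps I) : axialConstant I (i + 1) = ⊤ := by
  rw [axialConstant_succ]
  have : (⨅ (n : ℕ) (_ : Finsupp.single i n ∈ ginExps I), (n : ℕ∞)) = ⊤ := by
    simp [hp]
  rw [this]
  rfl

lemma exists_forall_single_mem_iff {N : Set (Fin d →₀ ℕ)} (hup : IsUpperSet N) {i : Fin d}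
    (h : ∃ n : ℕ, Finsupp.single i n ∈ N) : ∃ p : ℕ, ∀ n, Finsupp.single i n ∈ N ↔ p ≤ n := by
  classical
  refine ⟨Nat.find h, fun n => ⟨fun hn => Nat.find_min' h hn, fun hn => ?_⟩⟩
  exact hup (Finsupp.single_mono hn) (Nat.find_spec h)

/-- If a strongly stable set contains the `p`-th power of the `i`-th variable, then it contains all
monomials of degree at least `p` in the variables up to the `i`-th. -/
lemma degree_lt_of_mem_sectionAnnihilatorExps {N : Set (Fin d →₀ ℕ)}
    (hN : ∀ i j : Fin d, i < j → ∀ m, m + Finsupp.single j 1 ∈ N → m + Finsupp.single i 1 ∈ N)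
    {i : Fin d} {p : ℕ} (hp : ∀ n, Finsupp.single i n ∈ N ↔ p ≤ n) {m : Fin d →₀ ℕ}
    (hm : m ∈ sectionAnnihilatorExps N i) : m.degree < p := by
  by_contra! hle
  refine hm.2.1 ?_
  have := add_mem_of_single_degree_mem hN i m (fun j hj => ?_) 0 (by rwa [zero_add, hp])
  · rwa [zero_add] at this
  · by_contra! h
    exact hj (hm.1 j h)

lemma single_mem_sectionAnnihilatorExps {N : Set (Fin d →₀ ℕ)} {i : Fin d} {p : ℕ}
    (hp : ∀ n, Finsupp.single i n ∈ N ↔ p + 1 ≤ n) :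
    Finsupp.single i p ∈ sectionAnnihilatorExps N i := by
  refine ⟨fun j hj => Finsupp.single_eq_of_ne hj.ne', ?_, ?_⟩
  · rw [hp]
    omega
  · rw [← Finsupp.single_add, hp]

lemma genericAnnihilatorNumber_ne_zero_iff [Infinite k] {I : Ideal (MvPolynomial (Fin d) k)}
    (hI : I.IsHomogeneous (homogeneousSubmodule (Fin d) k)) (h : IsStronglyStable (ginRev I))
    (s : Fin d) (n : ℕ) :
    genericAnnihilatorNumber I s n ≠ 0 ↔
      ∃ m ∈ sectionAnnihilatorExps (ginExps I) s.rev, m.degree = n := by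
  have hfin := finite_sectionAnnihilatorExps (isUpperSet_ginExps I) (ginExps_add_single h)
  rw [genericAnnihilatorNumber_eq_ncard hI hfin, Ne, Set.ncard_eq_zero
    ((hfin s.rev).subset fun m hm => hm.1), ← Ne, ← Set.nonempty_iff_ne_empty]
  rfl

/-- For a strongly stable generic initial ideal, the coextremal annihilator numbers in the range of
the first `c` variables are those at which the axial constants jump. Here `p i` is the least
exponent of a power of the `i`-th variable. -/
lemma isCoextremal_rev_iff [Infinite k] {I : Ideal (MvPolynomial (Fin d) k)}
    (hI : I.IsHomogeneous (homogeneousSubmodule (Fin d) k)) (h : IsStronglyStable (ginRev I))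
    {p : Fin d → ℕ} {i : Fin d}
    (hp : ∀ i' ≤ i, ∀ n, Finsupp.single i' n ∈ ginExps I ↔ p i' ≤ n)
    (hp0 : ∀ i' ≤ i, p i' ≠ 0) (j : ℕ) :
    IsCoextremal I i.rev j ↔ p i = j + 1 ∧ ∀ i' < i, p i' < p i := by
  have hstab := ginExps_add_single h
  have hne := genericAnnihilatorNumber_ne_zero_iff hI h
  have hpow {i' : Fin d} (hi' : i' ≤ i) : ∃ m ∈ sectionAnnihilatorExps (ginExps I) i',
      m.degree = p i' - 1 := by
    refine ⟨Finsupp.single i' (p i' - 1), single_mem_sectionAnnihilatorExps fun n => ?_,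
      Finsupp.degree_single _ _⟩
    rw [hp i' hi', Nat.sub_add_cancel (Nat.one_le_iff_ne_zero.2 (hp0 i' hi'))]
  constructor
  · rintro ⟨h1, h2⟩
    obtain ⟨m, hm, hmj⟩ := (hne _ _).1 h1
    rw [Fin.rev_rev] at hm
    have hlt := degree_lt_of_mem_sectionAnnihilatorExps hstab (hp i le_rfl) hm
    have key {i' : Fin d} (hi' : i' ≤ i) (hj : j ≤ p i' - 1) : i' = i ∧ p i' - 1 = j := by
      by_contra hc
      refine (hne i'.rev (p i' - 1)).2 (by rw [Fin.rev_rev]; exact hpow hi')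
        (h2 _ _ (fun e => hc ?_) (Fin.rev_le_rev.2 hi') hj)
      rw [Prod.mk.injEq] at e
      exact ⟨Fin.rev_injective e.1, e.2⟩
    have hi := (key le_rfl (by omega)).2
    have h0 := hp0 i le_rfl
    refine ⟨by omega, fun i' hi' => lt_of_not_ge fun hge => ?_⟩
    exact hi'.ne (key hi'.le (by omega)).1
  · rintro ⟨h1, h2⟩
    refine ⟨(hne _ _).2 ?_, fun s n hsn hs hn => ?_⟩
    · rw [Fin.rev_rev]
      obtain ⟨m, hm, hmj⟩ := hpow le_rfl
      exact ⟨m, hm, by omega⟩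
    · by_contra hc
      obtain ⟨m, hm, hmn⟩ := (hne s n).1 hc
      have hsi : s.rev ≤ i := Fin.rev_le_iff.2 hs
      have hlt := degree_lt_of_mem_sectionAnnihilatorExps hstab (hp _ hsi) hm
      rcases hsi.eq_or_lt with e | hlt'
      · rw [e] at hlt
        refine hsn ?_
        rw [← e, Fin.rev_rev, Prod.mk.injEq]
        exact ⟨rfl, by omega⟩
      · have := h2 _ hlt'
        omega

end

end AxialConstants

open AxialConstants MvPolynomial in
theorem mainTheorem5 {k : Type*} [Field k] [Infinite k] (d c : ℕ)
    (I : Ideal (MvPolynomial (Fin d) k))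
    (hI : I.IsHomogeneous (MvPolynomial.homogeneousSubmodule (Fin d) k))
    (hI_top : I ≠ ⊤)
    (hc : I.height = (c : ℕ∞))
    (hgin : AxialConstants.IsStronglyStable (AxialConstants.ginRev I)) :
    (∀ (i : ℕ) (hi : 1 ≤ i) (hid : i ≤ d) (j : ℕ),
      (AxialConstants.axialConstant I (i - 1) < AxialConstants.axialConstant I i ∧
        AxialConstants.axialConstant I i = ((j + 1 : ℕ) : WithBot ℕ∞) ∧
        AxialConstants.axialConstant I i < ⊤) ↔
      (i ≤ c ∧ AxialConstants.IsCoextremal I ⟨d - i, by omega⟩ j)) ∧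
    {x : WithBot ℕ∞ | ∃ i : ℕ, 1 ≤ i ∧ i ≤ c ∧ x = AxialConstants.axialConstant I i} =
      {x : WithBot ℕ∞ | ∃ (s : Fin d) (j : ℕ), d - c ≤ (s : ℕ) ∧
        AxialConstants.IsCoextremal I s j ∧ x = ((j + 1 : ℕ) : WithBot ℕ∞)} ∧
    (∀ i i' : ℕ, 1 ≤ i → i ≤ i' → i' ≤ c →
      AxialConstants.axialConstant I i ≤ AxialConstants.axialConstant I i' ∧
        AxialConstants.axialConstant I i' < ⊤) ∧
    (∀ (i : ℕ) (hi : 1 ≤ i) (hid : i ≤ d), i ≤ c →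
      (AxialConstants.axialConstant I (i - 1) < AxialConstants.axialConstant I i ↔
        ∃ j : ℕ, AxialConstants.IsCoextremal I ⟨d - i, by omega⟩ j)) := by
  obtain ⟨hcd, hpow⟩ := exists_single_mem_ginExps_iff hI hI_top hc hgin
  have hup := isUpperSet_ginExps I
  have hstab := ginExps_add_single hgin
  have h0 : 0 ∉ ginExps I := by
    obtain ⟨g, hg⟩ := (generic_leadingExps_eq_ginExps hI).exists
    exact hg ▸ zero_notMem_leadingExps (map_coordChange_ne_top hI_top)
  -- `p i` is the value of the axial constant with number `i + 1`, for `i < c`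
  have hex (i : Fin d) : ∃ p : ℕ, (i : ℕ) < c → ∀ n, Finsupp.single i n ∈ ginExps I ↔ p ≤ n := by
    by_cases hi : (i : ℕ) < c
    · obtain ⟨p, hp⟩ := exists_forall_single_mem_iff hup ((hpow i).2 hi)
      exact ⟨p, fun _ => hp⟩
    · exact ⟨0, fun h => absurd h hi⟩
  choose p hp using hex
  have hcoe (i : Fin d) (hi : (i : ℕ) < c) : axialConstant I (i + 1) = ((p i : ℕ) : WithBot ℕ∞) :=
    axialConstant_succ_eq_coe (hp i hi)
  have hlt_top (n : ℕ) : ((n : ℕ) : WithBot ℕ∞) < ⊤ :=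
    WithBot.coe_lt_coe.2 (ENat.natCast_lt_top n)
  have hp0 (i : Fin d) (hi : (i : ℕ) < c) : p i ≠ 0 := by
    intro h
    have := (hp i hi 0).2 h.le
    rw [Finsupp.single_zero] at this
    exact h0 this
  have hmono {i i' : Fin d} (hii : i ≤ i') (hi' : (i' : ℕ) < c) : p i ≤ p i' := by
    have h1 := add_single_degree_mem hstab i (Finsupp.single i' (p i')) (fun l hl => by
      rw [Finsupp.single_apply_ne_zero] at hl
      rwa [hl.1]) 0 (by rw [zero_add, hp i' hi'])
    rwa [zero_add, Finsupp.degree_single, hp i (lt_of_le_of_lt hii hi')] at h1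
  have hjump (i : Fin d) (hi : (i : ℕ) < c) :
      axialConstant I i < axialConstant I (i + 1) ↔ ∀ i' < i, p i' < p i := by
    rw [hcoe i hi]
    obtain ⟨_ | i, hid⟩ := i
    · refine ⟨fun _ i' h => absurd (Fin.lt_def.1 h) (Nat.not_lt_zero _), fun _ => ?_⟩
      exact WithBot.bot_lt_coe _
    · have hid' : i < d := by omega
      rw [hcoe ⟨i, hid'⟩ (by simp only at hi ⊢; omega), Nat.cast_lt]
      refine ⟨fun h i' hi' => (hmono ?_ ?_).trans_lt h, fun h => h _ (Fin.mk_lt_mk.2 (by omega))⟩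
      · exact Nat.lt_succ_iff.1 (Fin.lt_def.1 hi')
      · exact Nat.lt_of_succ_lt hi
  have hcoext (i : Fin d) (hi : (i : ℕ) < c) (j : ℕ) :
      IsCoextremal I i.rev j ↔ p i = j + 1 ∧ ∀ i' < i, p i' < p i :=
    isCoextremal_rev_iff hI hgin (fun i' h => hp i' (lt_of_le_of_lt h hi))
      (fun i' h => hp0 i' (lt_of_le_of_lt h hi)) j
  refine ⟨?_, ?_, ?_, ?_⟩
  · rintro (_ | i) hi hid j
    · omega
    change (axialConstant I i < axialConstant I (i + 1) ∧ _) ↔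
      i + 1 ≤ c ∧ IsCoextremal I (Fin.rev ⟨i, hid⟩) j
    by_cases hic : i < c
    · rw [hcoext ⟨i, hid⟩ hic, ← hjump ⟨i, hid⟩ hic, hcoe ⟨i, hid⟩ hic, Nat.cast_inj]
      exact ⟨fun h => ⟨hic, h.2.1, h.1⟩, fun h => ⟨h.2.2, h.2.1, hlt_top _⟩⟩
    · refine ⟨fun h => absurd h.2.2 ?_, fun h => absurd h.1 (by omega)⟩
      have htop : axialConstant I (i + 1) = ⊤ := axialConstant_succ_eq_top (i := ⟨i, hid⟩)
        fun n hn => hic ((hpow ⟨i, hid⟩).1 ⟨n, hn⟩)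
      rw [htop]
      exact lt_irrefl _
  · ext x
    constructor
    · rintro ⟨_ | i, hi, hic, rfl⟩
      · omega
      have hid : i < d := by omega
      -- the first index with the same axial constant is a jump
      obtain ⟨t, ht, hmin⟩ := Finset.exists_min_image
        (Finset.univ.filter fun t : Fin d => (t : ℕ) < c ∧ p t = p ⟨i, hid⟩) id
        ⟨⟨i, hid⟩, by simpa using hic⟩
      simp only [Finset.mem_filter, Finset.mem_univ, true_and, id] at ht hmin
      have h1 := hp0 t ht.1
      refine ⟨t.rev, p t - 1, ?_, (hcoext t ht.1 _).2 ⟨by omega, fun i' hi' => ?_⟩, ?_⟩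
      · rw [Fin.val_rev]
        omega
      · refine lt_of_le_of_ne (hmono hi'.le ht.1) fun e => hi'.not_ge (hmin i' ⟨?_, e.trans ht.2⟩)
        exact lt_trans hi' ht.1
      · rw [Nat.sub_add_cancel (by omega), ht.2, hcoe ⟨i, hid⟩ hic]
    · rintro ⟨s, j, hs, hcs, rfl⟩
      have hsc : (s.rev : ℕ) < c := by
        rw [Fin.val_rev]
        omega
      rw [← Fin.rev_rev s, hcoext _ hsc] at hcs
      exact ⟨s.rev + 1, by omega, hsc, by rw [hcoe _ hsc, hcs.1]⟩
  · rintro (_ | i) (_ | i') hi hii hic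
    · omega
    · omega
    · omega
    · rw [hcoe ⟨i, by omega⟩ (show i < c by omega), hcoe ⟨i', by omega⟩ hic, Nat.cast_le]
      exact ⟨hmono (Fin.mk_le_mk.2 (by omega)) hic, hlt_top _⟩
  · rintro (_ | i) hi hid hic
    · omega
    change axialConstant I i < axialConstant I (i + 1) ↔
      ∃ j, IsCoextremal I (Fin.rev ⟨i, hid⟩) j
    have h1 := hp0 ⟨i, hid⟩ hic
    simp only [hcoext ⟨i, hid⟩ hic, ← hjump ⟨i, hid⟩ hic]
    exact ⟨fun h => ⟨p ⟨i, hid⟩ - 1, by omega, h⟩, fun ⟨_, _, h⟩ => h⟩
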